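/- Let $\mathcal P_n=\{\pm1\}\cdot\{I,X,Y,Z\}^{\otimes n}$, and let $D$ be the uniform distribution on the $n$-qubit Pauli measurements $\{(I+P)/2 : P\in\mathcal P_n\}$. For an $n$-qubit (mixed) state $\rho$ and a two-outcome measurement $\{E,I-E\}$, $0\le E\le I$, put $f_\rho(E)=2\operatorname{tr}(E\rho)-1$, which is the mean of the outcome $Y\in\{-1,1\}$ with $\Pr[Y=1]=\operatorname{tr}(E\rho)$; write $Y\sim f_\rho(E)$ and $\|h\|_D^2=\mathbb E_{E\sim D}[h(E)^2]$. A stabilizer state is a state $|\psi\rangle\langle\psi|$ such that $P|\psi\rangle=|\psi\rangle$ for all $P$ in some Abelian group $S\subset\mathcal P_n\setminus\{-I\}$ of order $2^n$; let $\mathcal C_n$ be the class of all $n$-qubit stabilizer states. An SQ algorithm adaptively makes queries $(\phi,t)$, where $\phi$ maps pairs (two-outcome measurement, label in $\{-1,1\}$) to $[-1,1]$ and $t>0$ is the tolerance; an SQ oracle for $\rho$ may respond with any real $y$ such that $|y-\mathbb E_{E\sim D,\,Y\sim f_\rho(E)}[\phi(E,Y)]|\le t$. After finitely many queries the algorithm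 outputs a state $\sigma$. It learns $\mathcal C_n$ over $D$ up to squared loss $\epsilon$ with $q$ queries of tolerance at least $\tau$ if all its tolerances are at least $\tau$ and if, for every $\rho\in\mathcal C_n$ and whatever the valid responses of the oracle for $\rho$ are, it makes at most $q$ queries and its output satisfies $\|f_\sigma-f_\rho\|_D^2\le\epsilon$. **Theorem.** (1) There are absolute constants $A>1$ and $c>0$ such that for every $\theta<1$ the following holds for all sufficiently large $n$. Let $\tau\ge 2^{-An}$ and $\epsilon\le\theta\,(2^{-n}-4^{-n})$. Then any SQ algorithm that learns $\mathcal C_n$ over $D$ up to squared loss $\epsilon$ with $q$ queries of tolerance at least $\tau$ has $q\ge 2^{cn^2}$. (2) For every $n$ and every $n$-qubit state $\rho$, $\|f_\rho\|_D^2=\|f_\rho-f_{I/2^n}\|_D^2+4^{-n}$. If $\rho$ is a stabilizer state, then $\|f_\rho\|_D^2=2^{-n}$, so that the maximally mixed state $I/2^n$ has squared loss exactly $2^{-n}-4^{-n}$ on $\rho$. Thus improving on the maximally mixed state by any constant factor $\theta<1$ requires $2^{\Omega(n^2)}$ queries, even with the exponentially small tolerance $2^{-An}$. -/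

import Mathlib

open Matrix
open scoped ComplexOrder BigOperators

noncomputable section

namespace SQStab

/-- Labels of the computational basis of `n` qubits. -/
abbrev Basis (n : ℕ) : Type := Fin n → Fin 2

/-- Operators on the `n`-qubit space, as `2 ^ n × 2 ^ n` complex matrices. -/
abbrev Op (n : ℕ) : Type := Matrix (Basis n) (Basis n) ℂ

/-- `n`-qubit mixed states: positive semidefinite operators of trace one. -/
structure QState (n : ℕ) where
  mat : Op n
  posSemidef : mat.PosSemidef
  trace_eq_one : mat.trace = 1

/-- Two-outcome `n`-qubit measurements `{E, I - E}`, given by the effect `0 ≤ E ≤ I`. -/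
structure Measurement (n : ℕ) where
  mat : Op n
  posSemidef : mat.PosSemidef
  posSemidef_compl : (1 - mat).PosSemidef

/-- The probability `tr (E ρ)` that the measurement `E` accepts `ρ`. -/
def acceptProb {n : ℕ} (ρ : QState n) (E : Measurement n) : ℝ :=
  (E.mat * ρ.mat).trace.re

/-- The p-concept `f_ρ (E) = 2 tr (E ρ) - 1`, the mean of the `±1`-valued outcome. -/
def pconcept {n : ℕ} (ρ : QState n) (E : Measurement n) : ℝ :=
  2 * acceptProb ρ E - 1

/-- The squared norm `E_{E ∼ D} [f_ρ (E) ^ 2]`, for `D` uniform on the finite set `D`. -/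
def sqNorm {n : ℕ} (D : Finset (Measurement n)) (ρ : QState n) : ℝ :=
  Finset.expect D fun E => pconcept ρ E ^ 2

/-- The squared loss `E_{E ∼ D} [(f_σ (E) - f_ρ (E)) ^ 2]`, for `D` uniform on the finite set
`D`. -/
def sqLoss {n : ℕ} (D : Finset (Measurement n)) (σ ρ : QState n) : ℝ :=
  Finset.expect D fun E => (pconcept σ E - pconcept ρ E) ^ 2

/-! ### Statistical queries -/

/-- A query function `φ : 𝓔 × {-1, 1} → [-1, 1]`; the type `ℤˣ` is `{1, -1}`. -/
abbrev Query (n : ℕ) : Type := Measurement n → ℤˣ → Set.Icc (-1 : ℝ) 1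

/-- `E [φ (E, Y)]` for `E` uniform on `D` and `Y` the outcome of measuring `ρ` using `E`. -/
def queryExpect {n : ℕ} (D : Finset (Measurement n)) (ρ : QState n) (φ : Query n) : ℝ :=
  Finset.expect D fun E =>
    acceptProb ρ E * (φ E 1 : ℝ) + (1 - acceptProb ρ E) * (φ E (-1) : ℝ)

/-- An adaptive SQ algorithm: it either stops and outputs a state, or makes a query `φ` of
tolerance `t` and goes on according to the real number with which the oracle responds. No
computational restriction is put on the algorithm. -/
inductive SQAlgorithm (n : ℕ) : Type
  | output (σ : QState n) : SQAlgorithm n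
  | ask (φ : Query n) (t : ℝ) (next : ℝ → SQAlgorithm n) : SQAlgorithm n

/-- All queries of the algorithm have (positive) tolerance at least `τ`. -/
def SQAlgorithm.ToleranceAtLeast {n : ℕ} (τ : ℝ) : SQAlgorithm n → Prop
  | .output _ => True
  | .ask _ t next => 0 < t ∧ τ ≤ t ∧ ∀ y, (next y).ToleranceAtLeast τ

/-- `A.Run D ρ q σ`: with some SQ oracle for `ρ` (that is, one whose response to every query is
within the tolerance of the true expectation), the algorithm `A` makes exactly `q` queries and
outputs `σ`. -/
inductive SQAlgorithm.Run {n : ℕ} (D : Finset (Measurement n)) (ρ : QState n) :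
    SQAlgorithm n → ℕ → QState n → Prop
  | output (σ : QState n) : SQAlgorithm.Run D ρ (.output σ) 0 σ
  | ask (φ : Query n) (t : ℝ) (next : ℝ → SQAlgorithm n) (y : ℝ) (q : ℕ) (σ : QState n)
      (hy : |y - queryExpect D ρ φ| ≤ t) (hrun : SQAlgorithm.Run D ρ (next y) q σ) :
      SQAlgorithm.Run D ρ (.ask φ t next) (q + 1) σ

/-- The class `C` is SQ-learnable over (the uniform distribution on) `D` up to squared loss `ε`
with at most `q` queries, all of tolerance at least `τ`: some algorithm does so for every unknown
`ρ ∈ C` and whatever the valid responses of the oracle are. -/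
def SQLearnable {n : ℕ} (D : Finset (Measurement n)) (C : Set (QState n)) (ε τ : ℝ) (q : ℕ) :
    Prop :=
  ∃ A : SQAlgorithm n, A.ToleranceAtLeast τ ∧
    ∀ ρ ∈ C, ∀ (k : ℕ) (σ : QState n), A.Run D ρ k σ → k ≤ q ∧ sqLoss D σ ρ ≤ ε

/-! ### Pauli operators, Pauli measurements, stabilizer states -/

/-- The one-qubit Pauli matrices `I, X, Y, Z`. -/
def pauli : Fin 4 → Matrix (Fin 2) (Fin 2) ℂ :=
  ![1, !![0, 1; 1, 0], !![0, -Complex.I; Complex.I, 0], !![1, 0; 0, -1]]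

/-- The tensor product of the one-qubit Pauli matrices `p 0, …, p (n - 1)`. -/
def pauliString {n : ℕ} (p : Fin n → Fin 4) : Op n :=
  Matrix.of fun i j => ∏ k, pauli (p k) (i k) (j k)

/-- The element `± p` of `𝓟_n = {± 1} · {I, X, Y, Z}^{⊗ n}`. -/
def signedPauli {n : ℕ} (s : ℤˣ) (p : Fin n → Fin 4) : Op n :=
  ((s : ℤ) : ℂ) • pauliString p

/-- The set `𝓟_n = {± 1} · {I, X, Y, Z}^{⊗ n}`. -/
def pauliOps (n : ℕ) : Set (Op n) :=
  {P | ∃ (s : ℤˣ) (p : Fin n → Fin 4), P = signedPauli s p}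

theorem pauli_mul_self (a : Fin 4) : pauli a * pauli a = 1 := by
  fin_cases a <;> ext i j <;> fin_cases i <;> fin_cases j <;>
    simp [pauli, Matrix.mul_apply, Fin.sum_univ_two]

theorem pauli_star (a : Fin 4) (i j : Fin 2) : star (pauli a j i) = pauli a i j := by
  fin_cases a <;> fin_cases i <;> fin_cases j <;> simp [pauli]

theorem pauliString_mul_self {n : ℕ} (p : Fin n → Fin 4) :
    pauliString p * pauliString p = 1 := by
  ext i j
  simp only [Matrix.mul_apply, pauliString, Matrix.of_apply, ← Finset.prod_mul_distrib]
  rw [← Fintype.prod_sum fun k x => pauli (p k) (i k) x * pauli (p k) x (j k)]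
  have h : ∀ k, ∑ x, pauli (p k) (i k) x * pauli (p k) x (j k) =
      (1 : Matrix (Fin 2) (Fin 2) ℂ) (i k) (j k) := fun k => by
    rw [← pauli_mul_self (p k), Matrix.mul_apply]
  simp only [h, Matrix.one_apply]
  by_cases hij : i = j
  · simp [hij]
  · obtain ⟨k, hk⟩ := Function.ne_iff.mp hij
    rw [if_neg hij]
    exact Finset.prod_eq_zero (Finset.mem_univ k) (by simp [hk])

theorem signedPauli_mul_self {n : ℕ} (s : ℤˣ) (p : Fin n → Fin 4) :
    signedPauli s p * signedPauli s p = 1 := by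
  rcases Int.units_eq_one_or s with rfl | rfl <;> simp [signedPauli, pauliString_mul_self]

theorem signedPauli_conjTranspose {n : ℕ} (s : ℤˣ) (p : Fin n → Fin 4) :
    (signedPauli s p)ᴴ = signedPauli s p := by
  have h : (pauliString p)ᴴ = pauliString p := by
    ext i j
    simp only [Matrix.conjTranspose_apply, pauliString, Matrix.of_apply, star_prod, pauli_star]
  rcases Int.units_eq_one_or s with rfl | rfl <;> simp [signedPauli, h]

theorem posSemidef_of_involution {n : ℕ} {P : Op n} (h₁ : P * P = 1) (h₂ : Pᴴ = P) :
    ((1 / 2 : ℂ) • (1 + P)).PosSemidef := by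
  have h : (1 / 2 : ℂ) • (1 + P) = ((1 / 2 : ℂ) • (1 + P))ᴴ * ((1 / 2 : ℂ) • (1 + P)) := by
    simp only [Matrix.conjTranspose_smul, Matrix.conjTranspose_add, h₂, Matrix.conjTranspose_one,
      Matrix.smul_mul, Matrix.mul_smul, Matrix.mul_add, Matrix.add_mul, h₁,
      Matrix.one_mul, Matrix.mul_one]
    ext i j
    simp only [Matrix.smul_apply, Matrix.add_apply, smul_eq_mul]
    norm_num
    ring
  rw [h]
  exact Matrix.posSemidef_conjTranspose_mul_self _

/-- The Pauli measurement `(I ± P) / 2`. -/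
def pauliMeasurement {n : ℕ} (s : ℤˣ) (p : Fin n → Fin 4) : Measurement n where
  mat := (1 / 2 : ℂ) • (1 + signedPauli s p)
  posSemidef :=
    posSemidef_of_involution (signedPauli_mul_self s p) (signedPauli_conjTranspose s p)
  posSemidef_compl := by
    have h : (1 : Op n) - (1 / 2 : ℂ) • (1 + signedPauli s p) =
        (1 / 2 : ℂ) • (1 + -signedPauli s p) := by
      ext i j
      simp only [Matrix.sub_apply, Matrix.smul_apply, Matrix.add_apply, Matrix.neg_apply,
        smul_eq_mul]
      ring
    rw [h]
    exact posSemidef_of_involution (by simp [signedPauli_mul_self])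
      (by simp [signedPauli_conjTranspose])

open Classical in
/-- The set `{(I + P) / 2 | P ∈ 𝓟_n}` of all Pauli measurements. -/
def pauliMeasurements (n : ℕ) : Finset (Measurement n) :=
  Finset.univ.image fun x : ℤˣ × (Fin n → Fin 4) => pauliMeasurement x.1 x.2

/-- `ρ` is a stabilizer state: there is an Abelian group `S ⊆ 𝓟_n` of order `2 ^ n`, not
containing `-I`, such that `ρ = |ψ⟩⟨ψ|` with `P ψ = ψ` for all `P ∈ S`. -/
def IsStabilizerState {n : ℕ} (ρ : QState n) : Prop :=
  ∃ S : Subgroup (Op n)ˣ,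
    (∀ P ∈ S, (P : Op n) ∈ pauliOps n) ∧ (-1 : (Op n)ˣ) ∉ S ∧
    (∀ P ∈ S, ∀ Q ∈ S, P * Q = Q * P) ∧ Nat.card S = 2 ^ n ∧
    ∃ ψ : Basis n → ℂ, ρ.mat = Matrix.vecMulVec ψ (star ψ) ∧
      ∀ P ∈ S, (P : Op n) *ᵥ ψ = ψ

/-- The class of all `n`-qubit stabilizer states. -/
def stabilizerStates (n : ℕ) : Set (QState n) := {ρ | IsStabilizerState ρ}

/-- The maximally mixed state `I / 2 ^ n`. -/
def maxMixed (n : ℕ) : QState n where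
  mat := ((1 / 2 ^ n : ℝ) : ℂ) • (1 : Op n)
  posSemidef := Matrix.PosSemidef.one.smul (by
    rw [Complex.zero_le_real]; positivity)
  trace_eq_one := by
    simp [Matrix.trace_smul, Matrix.trace_one]

end SQStab

end

noncomputable section

namespace SQStab

/-! ### Isotropic subspaces over the field with two elements -/

/-! The hard states are `quadState U`, with amplitudes `2^(-n/2) (-1)^(xᵀ U x)` and `U` ranging over
all `n × n` matrices over `ZMod 2`. Put `B = U + Uᵀ`. The only nonzero Pauli coefficients of such a
state sit at the strings `(a, B a)`, with values `± (-1)^(aᵀ U a)`. An oracle that answers as if all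
outcomes were fair coins errs by `2^(-n)` times `corr h U`, the average over `a` of `(-1)^(aᵀ U a) h
(a, B a)` for a bounded `h` read off from the query. A state `σ` that beats the maximally mixed
state must likewise have large `corr`, with `h` its Pauli coefficients. So it suffices that each
bounded `h` correlates with few `U` (`card_corr_gt_le`): each query then excludes few states, and
the output serves few (`card_le_of_learns`).

This follows from the `m`-th moment of `corr` for `m` of order `n`. After Fourier expansion of `h
(a, ·)` the sign is linear in the entries of `U` (`quad_add_dotProduct`), so averaging over `U`
leaves those `m`-tuples of pairs `(a_i, ξ_i)` whose `n` rows span an isotropic subspace `W` for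
`pairForm` (`sum_corr_pow_eq`). There are at most `2^(4m²)` subspaces. For each, the trivial bound
`|W|^n ≤ 2^(mn)` only cancels the normalization of the moment. `tupleSum_le` improves it to
`2^(5mn/6)`: either some `ξ_i` varies freely, and Cauchy-Schwarz with Parseval gains a factor
`2^(n/2)`, or the `a`-parts form a self-orthogonal code and `W` is small. -/

theorem card_sq_le_of_isotropic {V : Type*} [AddCommGroup V] [Module (ZMod 2) V] [Fintype V]
    (B : LinearMap.BilinForm (ZMod 2) V) (hB : LinearMap.ker B = ⊥) (W : Submodule (ZMod 2) V)
    (hW : ∀ w ∈ W, ∀ w' ∈ W, B w w' = 0) :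
    Nat.card W ^ 2 ≤ Nat.card V := by
  have h1 : W ≤ B.orthogonal W := fun w hw w' hw' => hW w' hw' w hw
  have h2 := LinearMap.BilinForm.finrank_add_finrank_orthogonal' (B := B) W
  rw [hB, inf_bot_eq, finrank_bot] at h2
  have h3 := Submodule.finrank_mono h1
  rw [Module.natCard_eq_pow_finrank (K := ZMod 2) (V := W),
    Module.natCard_eq_pow_finrank (K := ZMod 2) (V := V), ← pow_mul, Nat.card_zmod]
  exact Nat.pow_le_pow_right (by norm_num) (by omega)

/-- The bilinear form `∑ i, (a i * a' i + ξ i * a' i + a i * ξ' i)` on vectors of pairs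
`(a i, ξ i)`. -/
def pairForm (ι : Type*) [Fintype ι] :
    LinearMap.BilinForm (ZMod 2) (ι → ZMod 2 × ZMod 2) :=
  LinearMap.mk₂ _ (fun w w' => ∑ i, ((w i).1 * (w' i).1 + (w i).2 * (w' i).1 +
      (w i).1 * (w' i).2))
    (fun u v w => by
      simp only [← Finset.sum_add_distrib]
      exact Finset.sum_congr rfl fun i _ => by
        simp only [Pi.add_apply, Prod.fst_add, Prod.snd_add]
        ring)
    (fun c v w => by
      simp only [smul_eq_mul, Finset.mul_sum]
      exact Finset.sum_congr rfl fun i _ => by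
        simp only [Pi.smul_apply, Prod.smul_fst, Prod.smul_snd, smul_eq_mul]
        ring)
    (fun u v w => by
      simp only [← Finset.sum_add_distrib]
      exact Finset.sum_congr rfl fun i _ => by
        simp only [Pi.add_apply, Prod.fst_add, Prod.snd_add]
        ring)
    (fun c v w => by
      simp only [smul_eq_mul, Finset.mul_sum]
      exact Finset.sum_congr rfl fun i _ => by
        simp only [Pi.smul_apply, Prod.smul_fst, Prod.smul_snd, smul_eq_mul]
        ring)

variable {ι : Type*} [Fintype ι]

theorem pairForm_apply (w w' : ι → ZMod 2 × ZMod 2) :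
    pairForm ι w w' = ∑ i, ((w i).1 * (w' i).1 + (w i).2 * (w' i).1 + (w i).1 * (w' i).2) :=
  rfl

theorem ker_pairForm [DecidableEq ι] : LinearMap.ker (pairForm ι) = ⊥ := by
  rw [LinearMap.ker_eq_bot']
  intro w hw
  have h : ∀ i (x : ZMod 2 × ZMod 2), (w i).1 * x.1 + (w i).2 * x.1 + (w i).1 * x.2 = 0 := fun i x => by
    have := LinearMap.congr_fun hw (Pi.single i x)
    rw [pairForm_apply, Finset.sum_eq_single i] at this
    · simpa using this
    · intro j _ hj
      simp [Pi.single_eq_of_ne hj]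
    · simp
  funext i
  have h1 : (w i).1 = 0 := by simpa using h i (0, 1)
  have h2 : (w i).2 = 0 := by simpa [h1] using h i (1, 0)
  exact Prod.ext h1 h2

theorem card_le_of_pairForm_isotropic (W : Submodule (ZMod 2) (ι → ZMod 2 × ZMod 2))
    (hW : ∀ w ∈ W, ∀ w' ∈ W, pairForm ι w w' = 0) :
    Nat.card W ≤ 2 ^ Fintype.card ι := by
  classical
  have h := card_sq_le_of_isotropic _ ker_pairForm W hW
  have h2 : Nat.card (ι → ZMod 2 × ZMod 2) = (2 ^ Fintype.card ι) ^ 2 := by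
    rw [Nat.card_eq_fintype_card, Fintype.card_fun, Fintype.card_prod, ZMod.card, pow_right_comm]
    norm_num
  rw [h2] at h
  exact (Nat.pow_le_pow_iff_left (by norm_num)).1 h

/-- If on an isotropic subspace supported on `S` each `ξ i` vanishes with `a i`, then the `a`-parts
form a self-orthogonal code. -/
theorem card_sq_le_of_snd_eq_zero (W : Submodule (ZMod 2) (ι → ZMod 2 × ZMod 2)) (S : Finset ι)
    (hW : ∀ w ∈ W, ∀ w' ∈ W, pairForm ι w w' = 0) (hS : ∀ w ∈ W, ∀ i ∉ S, w i = 0)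
    (h : ∀ w ∈ W, ∀ i ∈ S, (w i).1 = 0 → (w i).2 = 0) :
    Nat.card W ^ 2 ≤ 2 ^ S.card := by
  classical
  let f : (ι → ZMod 2 × ZMod 2) →ₗ[ZMod 2] (S → ZMod 2) :=
    { toFun := fun w i => (w i).1
      map_add' := fun _ _ => rfl
      map_smul' := fun _ _ => rfl }
  have hinj : Function.Injective (fun w : W => (⟨f w, w, w.2, rfl⟩ : W.map f)) := by
    intro w w' hww
    have h1 : f w = f w' := congrArg Subtype.val hww
    have h2 : ∀ i, (w - w' : ι → ZMod 2 × ZMod 2) i = 0 := fun i => by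
      by_cases hi : i ∈ S
      · have h3 : ((w - w' : ι → ZMod 2 × ZMod 2) i).1 = 0 := by
          simpa [f, sub_eq_zero] using congrFun h1 ⟨i, hi⟩
        exact Prod.ext h3 (h _ (W.sub_mem w.2 w'.2) i hi h3)
      · exact hS _ (W.sub_mem w.2 w'.2) i hi
    exact Subtype.ext (sub_eq_zero.1 (funext h2))
  have hdot : ∀ w ∈ W.map f, ∀ w' ∈ W.map f, w ⬝ᵥ w' = 0 := by
    rintro _ ⟨w, hw, rfl⟩ _ ⟨w', hw', rfl⟩
    rw [← hW w hw w' hw', pairForm_apply, dotProduct,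
      ← Finset.sum_subset (Finset.subset_univ S) (fun i _ hi => by simp [hS w hw i hi]),
      ← Finset.sum_coe_sort S]
    refine Finset.sum_congr rfl fun i _ => ?_
    change (w i).1 * (w' i).1 = _
    rw [add_assoc, left_eq_add]
    -- At one coordinate the pairs occurring in `W` form a subspace of the plane that omits `(0,
    -- 1)`, so `ξ = c a` there, and the cross terms are `c a a' + c a a' = 0`.
    have key : ∀ a b a' b' : ZMod 2, (a = 0 → b = 0) → (a' = 0 → b' = 0) →
        (a + a' = 0 → b + b' = 0) → b * a' + a * b' = 0 := by decide
    exact key _ _ _ _ (h w hw i i.2) (h w' hw' i i.2) (h _ (W.add_mem hw hw') i i.2)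
  have hcard := card_sq_le_of_isotropic (dotProductBilin (ZMod 2) (ZMod 2)) (by
      rw [LinearMap.ker_eq_bot']
      intro w hw
      exact dotProduct_eq_zero w fun v => LinearMap.congr_fun hw v) (W.map f) hdot
  have h2 : Nat.card (S → ZMod 2) = 2 ^ S.card := by simp
  rw [h2] at hcard
  exact (Nat.pow_le_pow_left (Nat.card_le_card_of_injective _ hinj) 2).trans hcard

/-! ### Sums of products over tuples from an isotropic subspace -/

/-- `W` is the disjoint union of the cosets `s e + W'`, separately for each row of the tuple. The
section `s` need not be linear. -/
theorem sum_tuples_split {κ V E : Type*} [Fintype κ] [AddCommGroup V] [Module (ZMod 2) V]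
    [Fintype V] [AddCommGroup E] [Module (ZMod 2) E] [Fintype E] [DecidableEq κ]
    (W W' : Submodule (ZMod 2) V) [Fintype W] [Fintype W']
    (π : V →ₗ[ZMod 2] E) (s : E → V) (hsW : ∀ e, s e ∈ W) (hs : ∀ e, π (s e) = e)
    (hW' : ∀ w, w ∈ W' ↔ w ∈ W ∧ π w = 0) :
    Nat.card W = Nat.card E * Nat.card W' ∧ ∀ f : (κ → V) → ℝ,
      ∑ N : κ → W, f (fun k => N k) =
        ∑ u : κ → E, ∑ N : κ → W', f (fun k => s (u k) + N k) := by
  let e : E × W' ≃ W :=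
    { toFun := fun x => ⟨s x.1 + x.2, W.add_mem (hsW _) ((hW' _).1 x.2.2).1⟩
      invFun := fun w => (π w, ⟨w - s (π w), (hW' _).2 ⟨W.sub_mem w.2 (hsW _), by
        rw [map_sub, hs, sub_self]⟩⟩)
      left_inv := fun x => by
        have h : π (s x.1 + x.2) = x.1 := by rw [map_add, hs, ((hW' _).1 x.2.2).2, add_zero]
        ext <;> simp [h]
      right_inv := fun w => by simp }
  refine ⟨by rw [← Nat.card_congr e, Nat.card_prod], fun f => ?_⟩
  rw [← Fintype.sum_prod_type']
  refine (Fintype.sum_equiv ((Equiv.arrowProdEquivProdArrow κ (fun _ => E) (fun _ => W')).symm.trans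
    (Equiv.arrowCongr (Equiv.refl κ) e)) _ _ fun x => ?_).symm
  rfl

section TupleSum

variable {κ : Type*} [Fintype κ] [DecidableEq κ]

/-- `∑_N ∏_{i ∈ S} p (a_i, ξ_i)` over the matrices `N` of pairs whose rows, up to the fixed
offset `N₀`, lie in `W`; here `(a_i, ξ_i)` is the column `i`. -/
def tupleSum (p : (κ → ZMod 2) → (κ → ZMod 2) → ℝ)
    (S : Finset ι) (W : Submodule (ZMod 2) (ι → ZMod 2 × ZMod 2)) [Fintype W]
    (N₀ : κ → ι → ZMod 2 × ZMod 2) : ℝ :=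
  ∑ N : κ → W, ∏ i ∈ S, p (fun k => (N₀ k i + (N k : ι → ZMod 2 × ZMod 2) i).1)
    (fun k => (N₀ k i + (N k : ι → ZMod 2 × ZMod 2) i).2)

variable {p : (κ → ZMod 2) → (κ → ZMod 2) → ℝ}

/-- Eliminates column `i`: within a coset of `W'` this column is constant, so its factor comes out,
and what remains is a sum over fewer columns with a shifted offset. Hence the bound `M` has to be
uniform in the offset. -/
theorem tupleSum_le_of_split {E : Type*} [AddCommGroup E] [Module (ZMod 2) E] [Fintype E]
    [DecidableEq ι] (hp0 : ∀ a ξ, 0 ≤ p a ξ)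
    (S : Finset ι) (i : ι) (hi : i ∈ S) (W W' : Submodule (ZMod 2) (ι → ZMod 2 × ZMod 2))
    [Fintype W] [Fintype W']
    (π : (ι → ZMod 2 × ZMod 2) →ₗ[ZMod 2] E) (s : E → ι → ZMod 2 × ZMod 2)
    (hsW : ∀ e, s e ∈ W) (hs : ∀ e, π (s e) = e) (hW' : ∀ w, w ∈ W' ↔ w ∈ W ∧ π w = 0)
    (hi0 : ∀ w ∈ W', w i = 0) {C M : ℝ} (hM : 0 ≤ M)
    (hW'M : ∀ N₀, tupleSum p (S.erase i) W' N₀ ≤ M)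
    (N₀ : κ → ι → ZMod 2 × ZMod 2)
    (hC : ∑ u : κ → E, p (fun k => (N₀ k i + s (u k) i).1) (fun k => (N₀ k i + s (u k) i).2)
      ≤ C) :
    tupleSum p S W N₀ ≤ C * M := by
  unfold tupleSum
  rw [(sum_tuples_split (κ := κ) W W' π s hsW hs hW').2 (fun N => ∏ i ∈ S,
    p (fun k => (N₀ k i + N k i).1) (fun k => (N₀ k i + N k i).2))]
  refine le_trans ?_ (mul_le_mul_of_nonneg_right hC hM)
  rw [Finset.sum_mul]
  refine Finset.sum_le_sum fun u _ => ?_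
  refine le_trans (le_of_eq ?_)
    (mul_le_mul_of_nonneg_left (hW'M fun k => N₀ k + s (u k)) (hp0 _ _))
  rw [tupleSum, Finset.mul_sum]
  refine Finset.sum_congr rfl fun N _ => ?_
  rw [← Finset.mul_prod_erase S _ hi]
  congr 1
  · simp [hi0 _ (N _).2]
  · refine Finset.prod_congr rfl fun j _ => ?_
    simp [add_assoc]

/-- Columns in which `W` contains `(0, 1)` are eliminated one by one, each summed by `hp`. Once
there are none, `|W|² ≤ 2^|S|`, and the trivial bound `|W|^n` suffices because `|W|^6 ≤ |W|^4
2^|S|`. -/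
theorem tupleSum_le (hp0 : ∀ a ξ, 0 ≤ p a ξ) (hp1 : ∀ a ξ, p a ξ ≤ 1)
    (hp : ∀ a, ∑ ξ, p a ξ ≤ (8 : ℝ) ^ (Fintype.card κ / 6 : ℝ))
    (S : Finset ι) (W : Submodule (ZMod 2) (ι → ZMod 2 × ZMod 2)) [Fintype W]
    (hW : ∀ w ∈ W, ∀ w' ∈ W, pairForm ι w w' = 0) (hS : ∀ w ∈ W, ∀ i ∉ S, w i = 0)
    (N₀ : κ → ι → ZMod 2 × ZMod 2) :
    tupleSum p S W N₀ ≤ ((Nat.card W : ℝ) ^ 4 * 2 ^ S.card) ^ (Fintype.card κ / 6 : ℝ) := by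
  classical
  induction S using Finset.strongInduction generalizing W N₀ with
  | H S ih =>
    set x : ℝ := Fintype.card κ / 6 with hx
    have hx0 : 0 ≤ x := by positivity
    by_cases h : ∃ i ∈ S, ∃ v ∈ W, (v i).1 = 0 ∧ (v i).2 ≠ 0
    · obtain ⟨i, hi, v, hv, hv1, hv2⟩ := h
      have hv2' : (v i).2 = 1 := by
        have : ∀ t : ZMod 2, t ≠ 0 → t = 1 := by decide
        exact this _ hv2
      have hcard : S.card = (S.erase i).card + 1 := (Finset.card_erase_add_one hi).symm
      by_cases h' : ∀ w ∈ W, (w i).1 = 0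
      · let π : (ι → ZMod 2 × ZMod 2) →ₗ[ZMod 2] ZMod 2 :=
          LinearMap.snd _ _ _ ∘ₗ LinearMap.proj i
        let s : ZMod 2 → ι → ZMod 2 × ZMod 2 := fun e => e • v
        have hπ : ∀ w, π w = (w i).2 := fun _ => rfl
        have hsi : ∀ e, s e i = (0, e) := fun e => by simp [s, Prod.ext_iff, hv1, hv2']
        have hsW : ∀ e, s e ∈ W := fun e => W.smul_mem _ hv
        have hs : ∀ e, π (s e) = e := fun e => by rw [hπ, hsi]
        have hW' : ∀ w, w ∈ W ⊓ LinearMap.ker π ↔ w ∈ W ∧ π w = 0 := fun w => by simp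
        have hi0 : ∀ w ∈ W ⊓ LinearMap.ker π, w i = 0 := fun w hw =>
          Prod.ext (h' w hw.1) ((hW' w).1 hw).2
        have hc := (sum_tuples_split (κ := κ) W _ π s hsW hs hW').1
        rw [Nat.card_zmod] at hc
        refine (tupleSum_le_of_split hp0 S i hi W _ π s hsW hs hW' hi0 (by positivity)
          (fun N₁ => ih _ (Finset.erase_ssubset hi) (W ⊓ LinearMap.ker π)
            (fun w hw w' hw' => hW w hw.1 w' hw'.1) (fun w hw j hj => ?_) N₁) N₀
          (C := 8 ^ x) ?_).trans ?_
        · by_cases hji : j = i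
          · rw [hji]; exact hi0 w hw
          · exact hS w hw.1 j fun hjS => hj (Finset.mem_erase.2 ⟨hji, hjS⟩)
        · refine le_trans (le_of_eq ?_) (hp fun k => (N₀ k i).1)
          refine Fintype.sum_equiv (Equiv.addLeft fun k => (N₀ k i).2) _ _ fun u => ?_
          simp only [hsi, Prod.fst_add, Prod.snd_add, add_zero]
          rfl
        · rw [← Real.mul_rpow (by norm_num) (by positivity)]
          -- Here `|W| = 2 |W'|`, and there is room to spare: the column costs `8`, while the bound
          -- allows `2^4 * 2`.
          refine Real.rpow_le_rpow (by positivity) ?_ hx0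
          rw [hc, hcard, pow_succ (2 : ℝ)]
          push_cast
          nlinarith [show (0 : ℝ) ≤ (Nat.card ↥(W ⊓ LinearMap.ker π) : ℝ) ^ 4 *
            2 ^ (S.erase i).card by positivity]
      · push Not at h'
        obtain ⟨w₀, hw₀, hw₀1⟩ := h'
        have hw₀1' : (w₀ i).1 = 1 := by
          have : ∀ t : ZMod 2, t ≠ 0 → t = 1 := by decide
          exact this _ hw₀1
        let π : (ι → ZMod 2 × ZMod 2) →ₗ[ZMod 2] ZMod 2 × ZMod 2 := LinearMap.proj i
        -- Column `i` of `W` is the whole plane: `w₀` supplies the first coordinate and `v` corrects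
        -- the second.
        let s : ZMod 2 × ZMod 2 → ι → ZMod 2 × ZMod 2 := fun e =>
          e.1 • w₀ + (e.2 - e.1 * (w₀ i).2) • v
        have hπ : ∀ w, π w = w i := fun _ => rfl
        have hsi : ∀ e, s e i = e := fun e => by simp [s, Prod.ext_iff, hv1, hv2', hw₀1']
        have hsW : ∀ e, s e ∈ W := fun e => W.add_mem (W.smul_mem _ hw₀) (W.smul_mem _ hv)
        have hs : ∀ e, π (s e) = e := fun e => by rw [hπ, hsi]
        have hW' : ∀ w, w ∈ W ⊓ LinearMap.ker π ↔ w ∈ W ∧ π w = 0 := fun w => by simp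
        have hi0 : ∀ w ∈ W ⊓ LinearMap.ker π, w i = 0 := fun w hw => ((hW' w).1 hw).2
        have hc := (sum_tuples_split (κ := κ) W _ π s hsW hs hW').1
        rw [Nat.card_prod, Nat.card_zmod] at hc
        refine (tupleSum_le_of_split hp0 S i hi W _ π s hsW hs hW' hi0 (by positivity)
          (fun N₁ => ih _ (Finset.erase_ssubset hi) (W ⊓ LinearMap.ker π)
            (fun w hw w' hw' => hW w hw.1 w' hw'.1) (fun w hw j hj => ?_) N₁) N₀
          (C := 2 ^ Fintype.card κ * 8 ^ x) ?_).trans ?_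
        · by_cases hji : j = i
          · rw [hji]; exact hi0 w hw
          · exact hS w hw.1 j fun hjS => hj (Finset.mem_erase.2 ⟨hji, hjS⟩)
        · have h2 : ∑ a : κ → ZMod 2, ∑ ξ : κ → ZMod 2, p a ξ ≤ 2 ^ Fintype.card κ * 8 ^ x := by
            refine (Finset.sum_le_sum fun a _ => hp a).trans (le_of_eq ?_)
            simp
          refine le_trans (le_of_eq ?_) h2
          rw [← Fintype.sum_prod_type']
          refine Fintype.sum_equiv ((Equiv.addLeft fun k => N₀ k i).trans
            (Equiv.arrowProdEquivProdArrow κ (fun _ => ZMod 2) (fun _ => ZMod 2))) _ _ fun u => ?_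
          simp only [hsi]
          rfl
        · have h64 : (2 : ℝ) ^ Fintype.card κ = 64 ^ x := by
            rw [show (64 : ℝ) = 2 ^ (6 : ℝ) by norm_num, ← Real.rpow_mul (by norm_num), hx,
              mul_div_cancel₀ _ (by norm_num), Real.rpow_natCast]
          rw [h64, ← Real.mul_rpow (by norm_num) (by norm_num),
            ← Real.mul_rpow (by norm_num) (by positivity)]
          -- Here `|W| = 4 |W'|`, and the budget is exact: `64 * 8 = 4^4 * 2`.
          refine Real.rpow_le_rpow (by positivity) (le_of_eq ?_) hx0
          rw [hc, hcard, pow_succ (2 : ℝ)]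
          push_cast
          ring
    · push Not at h
      have hcard := card_sq_le_of_snd_eq_zero W S hW hS fun w hw i hi hi0 => h i hi w hw hi0
      have hcard' : (Nat.card W : ℝ) ^ 2 ≤ 2 ^ S.card := by exact_mod_cast hcard
      have h1 : tupleSum p S W N₀ ≤ (Nat.card W : ℝ) ^ Fintype.card κ := by
        refine (Finset.sum_le_sum fun N _ => Finset.prod_le_one (fun i _ => hp0 _ _)
          fun i _ => hp1 _ _).trans (le_of_eq ?_)
        simp [Nat.card_eq_fintype_card]
      refine h1.trans ?_
      have h6 : (Nat.card W : ℝ) ^ Fintype.card κ = ((Nat.card W : ℝ) ^ 6) ^ x := by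
        rw [← Real.rpow_natCast _ 6, ← Real.rpow_mul (by positivity), hx]
        push_cast
        rw [mul_div_cancel₀ _ (by norm_num), Real.rpow_natCast]
      rw [h6]
      refine Real.rpow_le_rpow (by positivity) ?_ hx0
      calc (Nat.card W : ℝ) ^ 6 = (Nat.card W : ℝ) ^ 4 * (Nat.card W : ℝ) ^ 2 := by ring
        _ ≤ _ := mul_le_mul_of_nonneg_left hcard' (by positivity)

/-- The number of subspaces of `(ZMod 2)^(2m)` is at most `2^(4m²)`. -/
theorem card_submodule_le (ι : Type*) [Fintype ι] :
    Nat.card (Submodule (ZMod 2) (ι → ZMod 2 × ZMod 2)) ≤ 2 ^ (4 * Fintype.card ι ^ 2) := by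
  classical
  set m := Fintype.card ι
  have hsurj : Function.Surjective fun f : Fin (2 * m) → ι → ZMod 2 × ZMod 2 =>
      Submodule.span (ZMod 2) (Set.range f) := by
    intro W
    have hfin : Module.finrank (ZMod 2) W ≤ 2 * m := by
      refine (Submodule.finrank_le W).trans (le_of_eq ?_)
      simp [Module.finrank_pi_fintype, m, mul_comm]
    let b := Module.finBasis (ZMod 2) W
    refine ⟨fun k => if hk : (k : ℕ) < Module.finrank (ZMod 2) W then b ⟨k, hk⟩ else 0,
      le_antisymm (Submodule.span_le.2 ?_) ?_⟩
    · rintro _ ⟨k, rfl⟩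
      dsimp only
      split_ifs with hk
      · exact (b ⟨k, hk⟩).2
      · exact W.zero_mem
    · have h1 : W = (Submodule.span (ZMod 2) (Set.range b)).map W.subtype := by
        rw [b.span_eq, Submodule.map_top, Submodule.range_subtype]
      conv_lhs => rw [h1]
      rw [Submodule.map_span, Submodule.span_le]
      rintro _ ⟨_, ⟨k, rfl⟩, rfl⟩
      exact Submodule.subset_span ⟨⟨k, k.2.trans_le hfin⟩, by simp⟩
  refine (Nat.card_le_card_of_surjective _ hsurj).trans (le_of_eq ?_)
  rw [Nat.card_eq_fintype_card, Fintype.card_fun, Fintype.card_fun, Fintype.card_prod, ZMod.card,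
    Fintype.card_fin, ← pow_mul, show 2 * 2 = 2 ^ 2 by norm_num, ← pow_mul]
  congr 1
  ring

/-- The sum over all matrices of pairs with isotropic row space. -/
theorem sum_isotropic_le [DecidableEq ι] (hp0 : ∀ a ξ, 0 ≤ p a ξ) (hp1 : ∀ a ξ, p a ξ ≤ 1)
    (hp : ∀ a, ∑ ξ, p a ξ ≤ (8 : ℝ) ^ (Fintype.card κ / 6 : ℝ)) :
    ∑ N : κ → ι → ZMod 2 × ZMod 2, (if ∀ k l, pairForm ι (N k) (N l) = 0 then
        ∏ i, p (fun k => (N k i).1) (fun k => (N k i).2) else 0) ≤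
      2 ^ (4 * Fintype.card ι ^ 2) * (2 : ℝ) ^ (5 * Fintype.card κ * Fintype.card ι / 6 : ℝ) := by
  classical
  let F : (κ → ι → ZMod 2 × ZMod 2) → ℝ := fun N =>
    ∏ i, p (fun k => (N k i).1) (fun k => (N k i).2)
  have hF : ∀ N, 0 ≤ F N := fun N => Finset.prod_nonneg fun i _ => hp0 _ _
  let Z : Submodule (ZMod 2) (ι → ZMod 2 × ZMod 2) → ℝ := fun W =>
    if ∀ w ∈ W, ∀ w' ∈ W, pairForm ι w w' = 0 then ∑ N : κ → W, F (fun k => N k) else 0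
  have hZ : ∀ W, Z W ≤ (2 : ℝ) ^ (5 * Fintype.card κ * Fintype.card ι / 6 : ℝ) := by
    intro W
    by_cases hW : ∀ w ∈ W, ∀ w' ∈ W, pairForm ι w w' = 0
    · have h1 : Z W = tupleSum p Finset.univ W (fun _ => 0) := by
        simp only [Z, if_pos hW, tupleSum, F, Pi.zero_apply, zero_add]
      rw [h1]
      refine (tupleSum_le hp0 hp1 hp _ W hW (by simp) _).trans ?_
      have h2 : (Nat.card W : ℝ) ≤ 2 ^ Fintype.card ι := by
        exact_mod_cast card_le_of_pairForm_isotropic W hW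
      have h3 : (Nat.card W : ℝ) ^ 4 * 2 ^ (Finset.univ : Finset ι).card ≤
          (2 : ℝ) ^ (5 * Fintype.card ι : ℝ) := by
        refine (mul_le_mul_of_nonneg_right (pow_le_pow_left₀ (by positivity) h2 4)
          (by positivity)).trans (le_of_eq ?_)
        rw [Finset.card_univ, ← pow_mul, ← pow_add, ← Real.rpow_natCast]
        congr 1
        push_cast
        ring
      refine (Real.rpow_le_rpow (by positivity) h3 (by positivity)).trans (le_of_eq ?_)
      rw [← Real.rpow_mul (by norm_num)]
      congr 1
      ring
    · simp only [Z, if_neg hW]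
      positivity
  have hsum : ∑ N : κ → ι → ZMod 2 × ZMod 2,
      (if ∀ k l, pairForm ι (N k) (N l) = 0 then F N else 0) ≤ ∑ W, Z W := by
    have h1 : ∀ W, Z W = ∑ N : κ → ι → ZMod 2 × ZMod 2,
        if (∀ w ∈ W, ∀ w' ∈ W, pairForm ι w w' = 0) ∧ ∀ k, N k ∈ W then F N else 0 := by
      intro W
      by_cases hW : ∀ w ∈ W, ∀ w' ∈ W, pairForm ι w w' = 0
      · simp only [Z, if_pos hW, and_iff_right hW]
        rw [← Finset.sum_filter]
        refine Finset.sum_bij (fun N _ k => (N k : ι → ZMod 2 × ZMod 2)) (by simp) ?_ ?_ (by simp)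
        · intro N _ N' _ h
          funext k
          exact Subtype.ext (congrFun h k)
        · intro N hN
          exact ⟨fun k => ⟨N k, (Finset.mem_filter.1 hN).2 k⟩, Finset.mem_univ _, rfl⟩
      · simp [Z, if_neg hW, hW]
    simp only [h1]
    rw [Finset.sum_comm]
    refine Finset.sum_le_sum fun N _ => ?_
    have hnn : ∀ W ∈ (Finset.univ : Finset (Submodule (ZMod 2) (ι → ZMod 2 × ZMod 2))), 0 ≤ if (∀ w ∈ W, ∀ w' ∈ W, pairForm ι w w' = 0) ∧
        ∀ k, N k ∈ W then F N else 0 := fun W _ => by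
      split_ifs
      · exact hF N
      · exact le_rfl
    split_ifs with hN
    -- Each matrix is charged to the span of its rows, which is isotropic because its generators are
    -- mutually orthogonal and self-orthogonal.
    · refine le_trans (le_of_eq ?_)
        (Finset.single_le_sum hnn (Finset.mem_univ (Submodule.span (ZMod 2) (Set.range N))))
      rw [if_pos]
      refine ⟨fun w hw w' hw' => ?_, fun k => Submodule.subset_span ⟨k, rfl⟩⟩
      induction hw, hw' using Submodule.span_induction₂ with
      | mem_mem x y hx hy =>
        obtain ⟨k, rfl⟩ := hx
        obtain ⟨l, rfl⟩ := hy
        exact hN k l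
      | zero_left => simp
      | zero_right => simp
      | add_left _ _ _ _ _ _ h1 h2 => rw [map_add, LinearMap.add_apply, h1, h2, add_zero]
      | add_right _ _ _ _ _ _ h1 h2 => rw [map_add, h1, h2, add_zero]
      | smul_left _ _ _ _ _ h => rw [map_smul, LinearMap.smul_apply, h, smul_zero]
      | smul_right _ _ _ _ _ h => rw [map_smul, h, smul_zero]
    · exact Finset.sum_nonneg hnn
  refine hsum.trans ((Finset.sum_le_sum fun W _ => hZ W).trans ?_)
  rw [Finset.sum_const, nsmul_eq_mul, Finset.card_univ, ← Nat.card_eq_fintype_card]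
  refine mul_le_mul_of_nonneg_right ?_ (by positivity)
  exact_mod_cast card_submodule_le ι

end TupleSum

/-! ### Moments of the correlation of a bounded function with a random quadratic form -/

/-- The character `(-1) ^ x` of `ZMod 2`. -/
def sgn (x : ZMod 2) : ℝ := if x = 0 then 1 else -1

@[simp] theorem sgn_zero : sgn 0 = 1 := by simp [sgn]

theorem sgn_add (x y : ZMod 2) : sgn (x + y) = sgn x * sgn y := by
  revert x y
  have h : ∀ x y : ZMod 2, (x + y = 0 ↔ (x = 0 ↔ y = 0)) := by decide
  intro x y
  by_cases hx : x = 0 <;> by_cases hy : y = 0 <;> simp [sgn, h x y, hx, hy]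

theorem sgn_sum {α : Type*} (s : Finset α) (f : α → ZMod 2) :
    sgn (∑ i ∈ s, f i) = ∏ i ∈ s, sgn (f i) := by
  classical
  induction s using Finset.induction_on with
  | empty => simp
  | insert a s ha ih => rw [Finset.sum_insert ha, Finset.prod_insert ha, sgn_add, ih]

theorem abs_sgn (x : ZMod 2) : |sgn x| = 1 := by
  unfold sgn
  split_ifs <;> simp

theorem sgn_mul_self (x : ZMod 2) : sgn x * sgn x = 1 := by
  unfold sgn
  split_ifs <;> simp

theorem sum_sgn_mul (c : ZMod 2) : ∑ t : ZMod 2, sgn (t * c) = if c = 0 then 2 else 0 := by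
  have h : ∀ f : ZMod 2 → ℝ, ∑ t, f t = f 0 + f 1 := fun f => Fin.sum_univ_two f
  rw [h]
  by_cases hc : c = 0
  · simp [hc]
    norm_num
  · simp [hc, sgn]

/-! ### Character sums, Fourier analysis and moments over `ZMod 2`. -/

section

variable {κ : Type*} [Fintype κ] [DecidableEq κ]

theorem sum_sgn_dotProduct (c : κ → ZMod 2) :
    ∑ x : κ → ZMod 2, sgn (x ⬝ᵥ c) = if c = 0 then 2 ^ Fintype.card κ else 0 := by
  simp only [dotProduct, sgn_sum]
  rw [← Fintype.prod_sum fun k t => sgn (t * c k)]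
  simp only [sum_sgn_mul]
  by_cases hc : c = 0
  · simp [hc]
  · obtain ⟨k, hk⟩ := Function.ne_iff.mp hc
    rw [if_neg hc]
    exact Finset.prod_eq_zero (Finset.mem_univ k) (if_neg hk)

theorem sum_sgn_matrix (c : κ → κ → ZMod 2) :
    ∑ U : Matrix κ κ (ZMod 2), sgn (∑ k, ∑ l, U k l * c k l) =
      if ∀ k l, c k l = 0 then 2 ^ (Fintype.card κ ^ 2) else 0 := by
  have h : ∑ U : Matrix κ κ (ZMod 2), sgn (∑ k, ∑ l, U k l * c k l) =
      ∑ U : κ → κ → ZMod 2, ∏ k, sgn (U k ⬝ᵥ c k) := by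
    simp only [sgn_sum, dotProduct]
    rfl
  rw [h, ← Fintype.prod_sum fun k x => sgn (x ⬝ᵥ c k)]
  simp only [sum_sgn_dotProduct]
  split_ifs with hc
  · have : ∀ k, c k = 0 := fun k => funext (hc k)
    simp only [this, if_true, Finset.prod_const, Finset.card_univ, ← pow_mul, sq]
  · push Not at hc
    obtain ⟨k, l, hkl⟩ := hc
    exact Finset.prod_eq_zero (Finset.mem_univ k) (if_neg fun h0 => hkl (congrFun h0 l))

/-- The Fourier coefficients of a function on `(ZMod 2)^κ`. -/
def fourier (f : (κ → ZMod 2) → ℝ) (ξ : κ → ZMod 2) : ℝ :=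
  (∑ b, f b * sgn (ξ ⬝ᵥ b)) / 2 ^ Fintype.card κ

theorem sum_sgn_mul_sgn (b b' : κ → ZMod 2) :
    ∑ ξ : κ → ZMod 2, sgn (ξ ⬝ᵥ b) * sgn (ξ ⬝ᵥ b') =
      if b = b' then 2 ^ Fintype.card κ else 0 := by
  simp only [← sgn_add, ← dotProduct_add, sum_sgn_dotProduct]
  refine if_congr ?_ rfl rfl
  constructor
  · intro h
    funext k
    have h1 : ∀ x y : ZMod 2, x + y = 0 → x = y := by decide
    exact h1 _ _ (congrFun h k)
  · rintro rfl
    funext k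
    exact CharTwo.add_self_eq_zero _

theorem sum_fourier_mul_sgn (f : (κ → ZMod 2) → ℝ) (b : κ → ZMod 2) :
    ∑ ξ, fourier f ξ * sgn (ξ ⬝ᵥ b) = f b := by
  simp only [fourier, Finset.sum_div, Finset.sum_mul]
  rw [Finset.sum_comm]
  have h : ∀ b', ∑ ξ : κ → ZMod 2, f b' * sgn (ξ ⬝ᵥ b') / 2 ^ Fintype.card κ * sgn (ξ ⬝ᵥ b) =
      if b' = b then f b' else 0 := fun b' => by
    have h1 : ∀ ξ : κ → ZMod 2, f b' * sgn (ξ ⬝ᵥ b') / 2 ^ Fintype.card κ * sgn (ξ ⬝ᵥ b) =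
        f b' / 2 ^ Fintype.card κ * (sgn (ξ ⬝ᵥ b') * sgn (ξ ⬝ᵥ b)) := fun ξ => by ring
    simp only [h1, ← Finset.mul_sum, sum_sgn_mul_sgn]
    split_ifs
    · field_simp
    · simp
  simp [h]

theorem sum_fourier_sq (f : (κ → ZMod 2) → ℝ) :
    ∑ ξ, fourier f ξ ^ 2 = (∑ b, f b ^ 2) / 2 ^ Fintype.card κ := by
  have h : ∀ ξ, fourier f ξ ^ 2 =
      ∑ b, f b / 2 ^ Fintype.card κ * (fourier f ξ * sgn (ξ ⬝ᵥ b)) := fun ξ => by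
    rw [sq]
    nth_rw 1 [fourier]
    rw [Finset.sum_div, Finset.sum_mul]
    exact Finset.sum_congr rfl fun b _ => by ring
  simp only [h]
  rw [Finset.sum_comm, Finset.sum_div]
  refine Finset.sum_congr rfl fun b _ => ?_
  rw [← Finset.mul_sum, sum_fourier_mul_sgn]
  ring

theorem abs_fourier_le_one (f : (κ → ZMod 2) → ℝ) (hf : ∀ b, |f b| ≤ 1) (ξ : κ → ZMod 2) :
    |fourier f ξ| ≤ 1 := by
  rw [fourier, abs_div, abs_of_pos (show (0 : ℝ) < 2 ^ Fintype.card κ by positivity),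
    div_le_one (by positivity)]
  refine (Finset.abs_sum_le_sum_abs _ _).trans ?_
  refine (Finset.sum_le_sum (g := fun _ => (1 : ℝ)) fun b _ => ?_).trans (by simp)
  rw [abs_mul, abs_sgn, mul_one]
  exact hf b

/-- Cauchy-Schwarz and Parseval give `2^(|κ|/2)`, written as `8^(|κ|/6)` to fit the exponent in
`tupleSum_le`. -/
theorem sum_abs_fourier_le (f : (κ → ZMod 2) → ℝ) (hf : ∀ b, |f b| ≤ 1) :
    ∑ ξ, |fourier f ξ| ≤ (8 : ℝ) ^ (Fintype.card κ / 6 : ℝ) := by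
  have h1 : ∑ ξ, fourier f ξ ^ 2 ≤ 1 := by
    rw [sum_fourier_sq, div_le_one (by positivity)]
    refine (Finset.sum_le_sum (g := fun _ => (1 : ℝ)) fun b _ => ?_).trans (by simp)
    rw [sq_le_one_iff_abs_le_one]
    exact hf b
  have h2 : (∑ ξ, |fourier f ξ|) ^ 2 ≤ 2 ^ Fintype.card κ := by
    refine sq_sum_le_card_mul_sum_sq.trans ?_
    simp only [sq_abs]
    refine (mul_le_mul_of_nonneg_left h1 (by positivity)).trans ?_
    simp
  have h3 : ((8 : ℝ) ^ (Fintype.card κ / 6 : ℝ)) ^ 2 = 2 ^ Fintype.card κ := by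
    rw [show (8 : ℝ) = 2 ^ (3 : ℝ) by norm_num, ← Real.rpow_natCast, ← Real.rpow_mul (by norm_num),
      ← Real.rpow_mul (by norm_num), ← Real.rpow_natCast]
    congr 1
    push_cast
    ring
  exact le_of_sq_le_sq (by rw [h3]; exact h2) (by positivity)

/-- The quadratic form `a ↦ aᵀ U a`. -/
def quad (U : Matrix κ κ (ZMod 2)) (a : κ → ZMod 2) : ZMod 2 := a ⬝ᵥ U *ᵥ a

/-- The correlation of `h (a, B a)` with `(-1) ^ (aᵀ U a)`, where `B = U + Uᵀ` is the polar form. -/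
def corr (h : (κ → ZMod 2) → (κ → ZMod 2) → ℝ) (U : Matrix κ κ (ZMod 2)) : ℝ :=
  (∑ a, sgn (quad U a) * h a ((U + Uᵀ) *ᵥ a)) / 2 ^ Fintype.card κ

-- For fixed `a` and `ξ` the exponent is linear in the entries of `U`, and the coefficients are one
-- summand of `pairForm` between rows `k` and `l`.
omit [DecidableEq κ] in
theorem quad_add_dotProduct (U : Matrix κ κ (ZMod 2)) (a ξ : κ → ZMod 2) :
    quad U a + ξ ⬝ᵥ (U + Uᵀ) *ᵥ a =
      ∑ k, ∑ l, U k l * (a k * a l + ξ k * a l + a k * ξ l) := by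
  have h1 : quad U a = ∑ k, ∑ l, U k l * (a k * a l) := by
    simp only [quad, dotProduct, mulVec, Finset.mul_sum]
    exact Finset.sum_congr rfl fun k _ => Finset.sum_congr rfl fun l _ => by ring
  have h2 : ξ ⬝ᵥ U *ᵥ a = ∑ k, ∑ l, U k l * (ξ k * a l) := by
    simp only [dotProduct, mulVec, Finset.mul_sum]
    exact Finset.sum_congr rfl fun k _ => Finset.sum_congr rfl fun l _ => by ring
  have h3 : ξ ⬝ᵥ Uᵀ *ᵥ a = ∑ k, ∑ l, U k l * (a k * ξ l) := by
    simp only [dotProduct, mulVec, Finset.mul_sum, transpose_apply]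
    rw [Finset.sum_comm]
    exact Finset.sum_congr rfl fun k _ => Finset.sum_congr rfl fun l _ => by ring
  rw [add_mulVec, dotProduct_add, h1, h2, h3]
  simp only [← Finset.sum_add_distrib]
  exact Finset.sum_congr rfl fun k _ => Finset.sum_congr rfl fun l _ => by ring

/-- Expand the power into `m`-tuples of columns `(a_i, ξ_i)` and transpose by `e`: the coefficient
of `U k l` becomes `pairForm` of rows `k` and `l`, and summing over `U` forces all of these to
vanish, including `k = l`. -/
theorem sum_corr_pow_eq (h : (κ → ZMod 2) → (κ → ZMod 2) → ℝ) (m : ℕ) :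
    ∑ U, corr h U ^ m = 2 ^ (Fintype.card κ ^ 2) / (2 ^ Fintype.card κ) ^ m *
      ∑ N : κ → Fin m → ZMod 2 × ZMod 2,
        (if ∀ k l, pairForm (Fin m) (N k) (N l) = 0 then
          ∏ i, fourier (h fun k => (N k i).1) (fun k => (N k i).2) else 0) := by
  let e : (Fin m → (κ → ZMod 2) × (κ → ZMod 2)) ≃ (κ → Fin m → ZMod 2 × ZMod 2) :=
    { toFun := fun x k i => ((x i).1 k, (x i).2 k)
      invFun := fun N i => (fun k => (N k i).1, fun k => (N k i).2)
      left_inv := fun _ => rfl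
      right_inv := fun _ => rfl }
  have h1 : ∀ U, corr h U ^ m = (∑ x : Fin m → (κ → ZMod 2) × (κ → ZMod 2),
      (∏ i, fourier (h (x i).1) (x i).2) *
        sgn (∑ k, ∑ l, U k l * pairForm (Fin m) (e x k) (e x l))) /
          (2 ^ Fintype.card κ) ^ m := by
    intro U
    have h2 : ∑ a, sgn (quad U a) * h a ((U + Uᵀ) *ᵥ a) =
        ∑ x : (κ → ZMod 2) × (κ → ZMod 2), fourier (h x.1) x.2 *
          sgn (∑ k, ∑ l, U k l * (x.1 k * x.1 l + x.2 k * x.1 l + x.1 k * x.2 l)) := by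
      rw [Fintype.sum_prod_type]
      refine Finset.sum_congr rfl fun a _ => ?_
      rw [← sum_fourier_mul_sgn (h a), Finset.mul_sum]
      refine Finset.sum_congr rfl fun ξ _ => ?_
      rw [← quad_add_dotProduct, sgn_add]
      ring
    rw [corr, div_pow, h2, Fintype.sum_pow]
    congr 1
    refine Finset.sum_congr rfl fun x _ => ?_
    rw [Finset.prod_mul_distrib, ← sgn_sum]
    congr 2
    simp only [pairForm_apply, Finset.mul_sum]
    rw [Finset.sum_comm]
    refine Finset.sum_congr rfl fun k _ => ?_
    rw [Finset.sum_comm]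
    rfl
  simp only [h1]
  rw [← Finset.sum_div, Finset.sum_comm, div_mul_eq_mul_div]
  congr 1
  rw [Finset.mul_sum]
  refine Fintype.sum_equiv e _ _ fun x => ?_
  rw [← Finset.mul_sum, sum_sgn_matrix]
  split_ifs
  · rw [mul_comm]
    rfl
  · simp

theorem sum_corr_pow_le (h : (κ → ZMod 2) → (κ → ZMod 2) → ℝ) (hh : ∀ a b, |h a b| ≤ 1) (m : ℕ) :
    ∑ U, corr h U ^ m ≤ 2 ^ (Fintype.card κ ^ 2) *
      (2 : ℝ) ^ (4 * (m : ℝ) ^ 2 - Fintype.card κ * m / 6) := by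
  have h1 := sum_isotropic_le (ι := Fin m) (κ := κ) (p := fun a ξ => |fourier (h a) ξ|)
    (fun _ _ => abs_nonneg _) (fun a ξ => abs_fourier_le_one _ (hh a) ξ)
    (fun a => sum_abs_fourier_le _ (hh a))
  rw [sum_corr_pow_eq]
  have h2 : ∑ N : κ → Fin m → ZMod 2 × ZMod 2,
        (if ∀ k l, pairForm (Fin m) (N k) (N l) = 0 then
          ∏ i, fourier (h fun k => (N k i).1) (fun k => (N k i).2) else 0) ≤ _ :=
    (Finset.sum_le_sum fun N _ => by
      split_ifs
      · rw [← Finset.abs_prod]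
        exact le_abs_self _
      · exact le_rfl).trans h1
  refine (mul_le_mul_of_nonneg_left h2 (by positivity)).trans (le_of_eq ?_)
  rw [div_mul_eq_mul_div, mul_div_assoc]
  congr 1
  rw [Fintype.card_fin, ← pow_mul, ← Real.rpow_natCast 2 (4 * m ^ 2), ← Real.rpow_natCast 2
    (Fintype.card κ * m), ← Real.rpow_add (by norm_num), ← Real.rpow_sub (by norm_num)]
  congr 1
  push_cast
  ring

/-- Few quadratic forms correlate with a given bounded function. -/
theorem card_corr_gt_le (h : (κ → ZMod 2) → (κ → ZMod 2) → ℝ) (hh : ∀ a b, |h a b| ≤ 1)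
    (T : Finset (Matrix κ κ (ZMod 2)))
    (hT : ∀ U ∈ T, (2 : ℝ) ^ (-(Fintype.card κ / 24 : ℝ)) ≤ |corr h U|) (m : ℕ) (hm : Even m) :
    (T.card : ℝ) ≤ 2 ^ (Fintype.card κ ^ 2) *
      (2 : ℝ) ^ (4 * (m : ℝ) ^ 2 - Fintype.card κ * m / 8) := by
  -- Markov's inequality for the `m`-th moment, with `m` even so that the terms outside `T` can be
  -- dropped. The exponent becomes `1/6 - 1/24 = 1/8`.
  have h1 : (T.card : ℝ) * ((2 : ℝ) ^ (-(Fintype.card κ / 24 : ℝ))) ^ m ≤ ∑ U, corr h U ^ m := by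
    rw [← nsmul_eq_mul, ← Finset.sum_const]
    refine (Finset.sum_le_sum fun U hU => ?_).trans
      (Finset.sum_le_sum_of_subset_of_nonneg (Finset.subset_univ T)
        fun U _ _ => hm.pow_nonneg _)
    rw [← hm.pow_abs (corr h U)]
    exact pow_le_pow_left₀ (by positivity) (hT U hU) m
  have h2 := h1.trans (sum_corr_pow_le h hh m)
  rw [← Real.rpow_natCast _ m, ← Real.rpow_mul (by norm_num)] at h2
  refine (le_div_iff₀ (by positivity)).2 h2 |>.trans (le_of_eq ?_)
  rw [mul_div_assoc, ← Real.rpow_sub (by norm_num)]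
  congr 2
  ring

end

/-! ### Pauli strings and Pauli measurements -/

theorem trace_pauli_mul_pauli (a b : Fin 4) :
    (pauli a * pauli b).trace = if a = b then 2 else 0 := by
  fin_cases a <;> fin_cases b <;>
    simp [pauli, Matrix.trace, Fin.sum_univ_two] <;> norm_num

theorem sum_pauli_mul_pauli (i j k l : Fin 2) :
    ∑ a, pauli a i j * pauli a k l = if i = l ∧ j = k then 2 else 0 := by
  fin_cases i <;> fin_cases j <;> fin_cases k <;> fin_cases l <;>
    simp [pauli, Fin.sum_univ_four] <;> norm_num

theorem trace_pauliString_mul {n : ℕ} (p q : Fin n → Fin 4) :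
    (pauliString p * pauliString q).trace = if p = q then 2 ^ n else 0 := by
  have h : (pauliString p * pauliString q).trace = ∏ k, (pauli (p k) * pauli (q k)).trace := by
    simp only [Matrix.trace, Matrix.diag_apply, Matrix.mul_apply, pauliString, Matrix.of_apply,
      ← Finset.prod_mul_distrib]
    rw [Fintype.prod_sum fun k x => ∑ y, pauli (p k) x y * pauli (q k) y x]
    refine Finset.sum_congr rfl fun x _ => ?_
    rw [Fintype.prod_sum fun k y => pauli (p k) (x k) y * pauli (q k) y (x k)]
  rw [h]
  simp only [trace_pauli_mul_pauli]
  split_ifs with hpq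
  · simp [hpq]
  · obtain ⟨k, hk⟩ := Function.ne_iff.mp hpq
    exact Finset.prod_eq_zero (Finset.mem_univ k) (if_neg hk)

/-- Completeness of the Paulis: `∑ P ⊗ P` is `2^n` times the swap. It yields the Parseval identity
`sum_trace_pauliString_mul`. -/
theorem sum_pauliString_mul {n : ℕ} (i j k l : Basis n) :
    ∑ p : Fin n → Fin 4, pauliString p i j * pauliString p k l =
      if i = l ∧ j = k then 2 ^ n else 0 := by
  simp only [pauliString, Matrix.of_apply, ← Finset.prod_mul_distrib]
  rw [← Fintype.prod_sum fun x a => pauli a (i x) (j x) * pauli a (k x) (l x)]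
  simp only [sum_pauli_mul_pauli]
  split_ifs with h
  · simp [h.1, h.2]
  · rw [not_and_or] at h
    rcases h with h | h <;> obtain ⟨x, hx⟩ := Function.ne_iff.mp h <;>
      exact Finset.prod_eq_zero (Finset.mem_univ x) (if_neg (by simp [hx]))

theorem sum_trace_pauliString_mul {n : ℕ} (M N : Op n) :
    ∑ p : Fin n → Fin 4, (pauliString p * M).trace * (pauliString p * N).trace =
      2 ^ n * (M * N).trace := by
  have h : ∀ p : Fin n → Fin 4, (pauliString p * M).trace * (pauliString p * N).trace =
      ∑ i, ∑ j, ∑ k, ∑ l, pauliString p i j * pauliString p k l * (M j i * N l k) := fun p => by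
    rw [mul_comm]
    simp only [Matrix.trace, Matrix.diag_apply, Matrix.mul_apply, Finset.sum_mul, Finset.mul_sum]
    refine Finset.sum_congr rfl fun i _ => Finset.sum_congr rfl fun j _ =>
      Finset.sum_congr rfl fun k _ => Finset.sum_congr rfl fun l _ => by ring
  simp only [h]
  rw [Finset.sum_comm]
  simp only [Matrix.trace, Matrix.diag_apply, Matrix.mul_apply, Finset.mul_sum]
  rw [Finset.sum_comm (s := Finset.univ (α := Basis n))
    (f := fun x i => (2 : ℂ) ^ n * (M x i * N i x))]
  refine Finset.sum_congr rfl fun i _ => ?_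
  rw [Finset.sum_comm]
  refine Finset.sum_congr rfl fun j _ => ?_
  rw [Finset.sum_comm, Finset.sum_eq_single j]
  · rw [Finset.sum_comm, Finset.sum_eq_single i]
    · rw [← Finset.sum_mul, sum_pauliString_mul]
      simp
    · intro l _ hl
      rw [← Finset.sum_mul, sum_pauliString_mul, if_neg (fun h => hl h.1.symm), zero_mul]
    · simp
  · intro k _ hk
    rw [Finset.sum_comm]
    refine Finset.sum_eq_zero fun l _ => ?_
    rw [← Finset.sum_mul, sum_pauliString_mul, if_neg (fun h => hk h.2.symm), zero_mul]
  · simp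

theorem pauliString_zero (n : ℕ) : pauliString (0 : Fin n → Fin 4) = 1 := by
  ext i j
  simp only [pauliString, Matrix.of_apply, Pi.zero_apply, pauli, Matrix.cons_val_zero,
    Matrix.one_apply]
  split_ifs with hij
  · simp [hij]
  · obtain ⟨k, hk⟩ := Function.ne_iff.mp hij
    exact Finset.prod_eq_zero (Finset.mem_univ k) (if_neg hk)

theorem pauliString_conjTranspose {n : ℕ} (p : Fin n → Fin 4) :
    (pauliString p)ᴴ = pauliString p := by
  simpa [signedPauli] using signedPauli_conjTranspose 1 p

/-- The coefficient `tr (P ρ)` of the Pauli string `P`. -/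
def pauliCoeff {n : ℕ} (ρ : QState n) (p : Fin n → Fin 4) : ℝ :=
  (pauliString p * ρ.mat).trace.re

theorem ofReal_pauliCoeff {n : ℕ} (ρ : QState n) (p : Fin n → Fin 4) :
    ((pauliCoeff ρ p : ℝ) : ℂ) = (pauliString p * ρ.mat).trace := by
  rw [pauliCoeff, ← Complex.conj_eq_iff_re, ← Complex.star_def, ← Matrix.trace_conjTranspose,
    Matrix.conjTranspose_mul, pauliString_conjTranspose, ρ.posSemidef.isHermitian.eq,
    Matrix.trace_mul_comm]

theorem acceptProb_pauliMeasurement {n : ℕ} (ρ : QState n) (s : ℤˣ) (p : Fin n → Fin 4) :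
    acceptProb ρ (pauliMeasurement s p) = (1 + (s : ℤ) * pauliCoeff ρ p) / 2 := by
  have h : ((pauliMeasurement s p).mat * ρ.mat).trace =
      (((1 + (s : ℤ) * pauliCoeff ρ p) / 2 : ℝ) : ℂ) := by
    simp only [pauliMeasurement, signedPauli, Matrix.smul_mul, Matrix.add_mul, Matrix.one_mul,
      Matrix.trace_smul, Matrix.trace_add, ρ.trace_eq_one, smul_eq_mul, ← ofReal_pauliCoeff]
    push_cast
    ring
  rw [acceptProb, h, Complex.ofReal_re]

theorem pconcept_pauliMeasurement {n : ℕ} (ρ : QState n) (s : ℤˣ) (p : Fin n → Fin 4) :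
    pconcept ρ (pauliMeasurement s p) = (s : ℤ) * pauliCoeff ρ p := by
  rw [pconcept, acceptProb_pauliMeasurement]
  ring

open scoped MatrixOrder Matrix.Norms.L2Operator in
theorem posSemidef_trace_mul_re_nonneg {n : ℕ} {A B : Op n} (hA : A.PosSemidef)
    (hB : B.PosSemidef) : 0 ≤ (A * B).trace.re := by
  obtain ⟨C, rfl⟩ := CStarAlgebra.nonneg_iff_eq_star_mul_self.1 hB.nonneg
  rw [Matrix.star_eq_conjTranspose]
  have h1 : (A * (Cᴴ * C)).trace = (C * A * Cᴴ).trace := by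
    rw [← Matrix.mul_assoc, Matrix.trace_mul_comm, Matrix.mul_assoc]
  rw [h1]
  exact (Complex.le_def.1 (hA.mul_mul_conjTranspose_same C).trace_nonneg).1

theorem abs_pauliCoeff_le_one {n : ℕ} (ρ : QState n) (p : Fin n → Fin 4) :
    |pauliCoeff ρ p| ≤ 1 := by
  have h : ∀ s : ℤˣ, 0 ≤ (1 + (s : ℤ) * pauliCoeff ρ p) / 2 := fun s => by
    rw [← acceptProb_pauliMeasurement]
    exact posSemidef_trace_mul_re_nonneg (pauliMeasurement s p).posSemidef ρ.posSemidef
  have h1 := h 1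
  have h2 := h (-1)
  push_cast at h1 h2
  rw [abs_le]
  constructor <;> linarith

/-- Makes the image in `pauliMeasurements` free of collisions, so that the uniform average runs over
`2 * 4^n` terms. -/
theorem pauliMeasurement_injective (n : ℕ) :
    Function.Injective fun x : ℤˣ × (Fin n → Fin 4) => pauliMeasurement x.1 x.2 := by
  rintro ⟨s, p⟩ ⟨s', p'⟩ h
  have h1 : signedPauli s p = signedPauli s' p' := by
    have h2 : (1 / 2 : ℂ) • (1 + signedPauli s p) = (1 / 2 : ℂ) • (1 + signedPauli s' p') :=
      congrArg Measurement.mat h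
    exact add_left_cancel (smul_right_injective _ (by norm_num : (1 / 2 : ℂ) ≠ 0) h2)
  have h3 : ∀ r : ℤˣ, ∀ q : Fin n → Fin 4, (signedPauli r q * pauliString p).trace =
      ((r : ℤ) : ℂ) * if q = p then 2 ^ n else 0 := fun r q => by
    rw [signedPauli, Matrix.smul_mul, Matrix.trace_smul, trace_pauliString_mul, smul_eq_mul]
  have h4 : ((s : ℤ) : ℂ) * 2 ^ n = ((s' : ℤ) : ℂ) * if p' = p then 2 ^ n else 0 := by
    rw [← h3, ← h1, h3, if_pos rfl]
  have h5 : p' = p := by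
    by_contra hne
    rw [if_neg hne, mul_zero] at h4
    rcases Int.units_eq_one_or s with rfl | rfl <;> simp at h4
  rw [if_pos h5] at h4
  have h6 : ((s : ℤ) : ℂ) = ((s' : ℤ) : ℂ) := mul_right_cancel₀ (by positivity) h4
  exact Prod.ext (Units.ext (by exact_mod_cast h6)) h5.symm

theorem expect_pauliMeasurements {n : ℕ} (f : Measurement n → ℝ) :
    Finset.expect (pauliMeasurements n) f =
      (∑ p, (f (pauliMeasurement 1 p) + f (pauliMeasurement (-1) p))) / (2 * 4 ^ n) := by
  classical
  have hu : ∀ g : ℤˣ → ℝ, ∑ s, g s = g 1 + g (-1) := fun g => by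
    rw [show (Finset.univ : Finset ℤˣ) = {1, -1} from rfl, Finset.sum_pair (by decide)]
  rw [pauliMeasurements, Finset.expect_image (pauliMeasurement_injective n).injOn,
    Finset.expect_eq_sum_div_card]
  congr 1
  · rw [Fintype.sum_prod_type_right]
    exact Finset.sum_congr rfl fun p _ => hu _
  · simp

/-! ### The squared norm and the squared loss -/

theorem sqNorm_eq {n : ℕ} (ρ : QState n) :
    sqNorm (pauliMeasurements n) ρ = (∑ p, pauliCoeff ρ p ^ 2) / 4 ^ n := by
  rw [sqNorm, expect_pauliMeasurements, mul_comm (2 : ℝ), ← div_div, div_right_comm, Finset.sum_div]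
  congr 1
  refine Finset.sum_congr rfl fun p _ => ?_
  simp only [pconcept_pauliMeasurement]
  push_cast
  ring

theorem sqLoss_eq {n : ℕ} (σ ρ : QState n) :
    sqLoss (pauliMeasurements n) σ ρ = (∑ p, (pauliCoeff σ p - pauliCoeff ρ p) ^ 2) / 4 ^ n := by
  rw [sqLoss, expect_pauliMeasurements, mul_comm (2 : ℝ), ← div_div, div_right_comm, Finset.sum_div]
  congr 1
  refine Finset.sum_congr rfl fun p _ => ?_
  simp only [pconcept_pauliMeasurement]
  push_cast
  ring

theorem pauliCoeff_zero {n : ℕ} (ρ : QState n) : pauliCoeff ρ 0 = 1 := by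
  rw [pauliCoeff, pauliString_zero, Matrix.one_mul, ρ.trace_eq_one, Complex.one_re]

theorem pauliCoeff_maxMixed (n : ℕ) (p : Fin n → Fin 4) :
    pauliCoeff (maxMixed n) p = if p = 0 then 1 else 0 := by
  split_ifs with h
  · rw [h, pauliCoeff_zero]
  · have h1 := trace_pauliString_mul p 0
    rw [if_neg h, pauliString_zero] at h1
    rw [pauliCoeff, maxMixed, Matrix.mul_smul, Matrix.trace_smul, h1, smul_zero, Complex.zero_re]

theorem sqNorm_eq_sqLoss_maxMixed_add {n : ℕ} (ρ : QState n) :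
    sqNorm (pauliMeasurements n) ρ =
      sqLoss (pauliMeasurements n) (maxMixed n) ρ + 1 / 4 ^ n := by
  rw [sqNorm_eq, sqLoss_eq, ← add_div]
  congr 1
  rw [← Finset.add_sum_erase _ _ (Finset.mem_univ (0 : Fin n → Fin 4)),
    ← Finset.add_sum_erase _ _ (Finset.mem_univ (0 : Fin n → Fin 4)), pauliCoeff_zero,
    pauliCoeff_zero, Finset.sum_congr rfl (fun p hp => by
      rw [pauliCoeff_maxMixed, if_neg (Finset.ne_of_mem_erase hp), zero_sub, neg_sq] :
      ∀ p ∈ Finset.univ.erase (0 : Fin n → Fin 4),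
        (pauliCoeff (maxMixed n) p - pauliCoeff ρ p) ^ 2 = pauliCoeff ρ p ^ 2)]
  ring

/-- Only purity matters: Parseval gives `∑ tr(Pρ)² = 2^n tr(ρ²) = 2^n`. -/
theorem sqNorm_of_isStabilizerState {n : ℕ} {ρ : QState n} (hρ : IsStabilizerState ρ) :
    sqNorm (pauliMeasurements n) ρ = 1 / 2 ^ n := by
  obtain ⟨S, -, -, -, -, ψ, hψ, -⟩ := hρ
  have h1 : star ψ ⬝ᵥ ψ = 1 := by
    rw [← ρ.trace_eq_one, hψ, Matrix.trace_vecMulVec, dotProduct_comm]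
  have h2 : ρ.mat * ρ.mat = ρ.mat := by
    rw [hψ, Matrix.vecMulVec_mul_vecMulVec, h1, one_smul]
  have h3 : ∑ p, pauliCoeff ρ p ^ 2 = 2 ^ n := by
    have h4 := sum_trace_pauliString_mul ρ.mat ρ.mat
    rw [h2, ρ.trace_eq_one] at h4
    simp only [← ofReal_pauliCoeff, ← sq] at h4
    have h5 : ((∑ p, pauliCoeff ρ p ^ 2 : ℝ) : ℂ) = ((2 ^ n : ℝ) : ℂ) := by
      push_cast
      rw [h4, mul_one]
    exact_mod_cast h5
  rw [sqNorm_eq, h3, div_eq_div_iff (by positivity) (by positivity), ← mul_pow]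
  norm_num

/-! ### Stabilizer states of quadratic forms -/

section Quad

variable {κ : Type*} [Fintype κ]

theorem quad_add (U : Matrix κ κ (ZMod 2)) (x a : κ → ZMod 2) :
    quad U (x + a) = quad U x + quad U a + ((U + Uᵀ) *ᵥ a) ⬝ᵥ x := by
  have h : x ⬝ᵥ Uᵀ *ᵥ a = a ⬝ᵥ U *ᵥ x := by
    rw [mulVec_transpose, dotProduct_comm, dotProduct_mulVec]
  rw [quad, quad, quad, mulVec_add, dotProduct_add, add_dotProduct, add_dotProduct,
    dotProduct_comm _ x, add_mulVec, dotProduct_add, h]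
  ring

theorem dotProduct_polar_self (U : Matrix κ κ (ZMod 2)) (a : κ → ZMod 2) :
    a ⬝ᵥ (U + Uᵀ) *ᵥ a = 0 := by
  have h : a ⬝ᵥ Uᵀ *ᵥ a = a ⬝ᵥ U *ᵥ a := by
    rw [mulVec_transpose, dotProduct_comm, dotProduct_mulVec]
  rw [add_mulVec, dotProduct_add, h, CharTwo.add_self_eq_zero]

end Quad

/-! ### Binary coordinates for Pauli strings, and the stabilizers of quadratic-form states. -/

variable {n : ℕ}

/-- The elements of `ZMod 2` as labels of the computational basis of a qubit. -/
def toBit : ZMod 2 ≃ Fin 2 := Equiv.refl _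

/-- Binary vectors as labels of the computational basis. -/
def toBasis (n : ℕ) : (Fin n → ZMod 2) ≃ Basis n := Equiv.arrowCongr (Equiv.refl _) toBit

theorem op_ext {M N : Op n} (h : ∀ x y, M (toBasis n x) (toBasis n y) =
    N (toBasis n x) (toBasis n y)) : M = N := by
  ext i j
  simpa using h ((toBasis n).symm i) ((toBasis n).symm j)

/-- The Pauli matrix that is `X ^ a Z ^ b` up to a phase. -/
def pauliIndex (x : ZMod 2 × ZMod 2) : Fin 4 :=
  if x.1 = 0 then (if x.2 = 0 then 0 else 3) else (if x.2 = 0 then 1 else 2)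

theorem pauliIndex_bijective : Function.Bijective pauliIndex := by
  constructor
  · unfold Function.Injective pauliIndex
    decide
  · unfold Function.Surjective pauliIndex
    decide

/-- Pauli strings are indexed by pairs of binary vectors. -/
def pauliEquiv (n : ℕ) : (Fin n → ZMod 2) × (Fin n → ZMod 2) ≃ (Fin n → Fin 4) :=
  (Equiv.arrowProdEquivProdArrow (Fin n) (fun _ => ZMod 2) (fun _ => ZMod 2)).symm.trans
    (Equiv.arrowCongr (Equiv.refl _) (Equiv.ofBijective _ pauliIndex_bijective))

theorem sum_pauliStrings {M : Type*} [AddCommMonoid M] (f : (Fin n → Fin 4) → M) :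
    ∑ p, f p = ∑ a, ∑ b, f (pauliEquiv n (a, b)) := by
  rw [← (pauliEquiv n).sum_comp, Fintype.sum_prod_type]

/-- The phase of the Pauli string of `(a, b)` relative to `X ^ a Z ^ b`. -/
def pauliPhase (a b : Fin n → ZMod 2) : ℂ :=
  ∏ k, if a k * b k = 0 then 1 else Complex.I

theorem pauli_pauliIndex (a b x y : ZMod 2) :
    pauli (pauliIndex (a, b)) (toBit x) (toBit y) =
      if x = y + a then (if a * b = 0 then 1 else Complex.I) * ((sgn (b * y) : ℝ) : ℂ) else 0 := by
  have h2 : ∀ t : ZMod 2, t = 0 ∨ t = 1 := by decide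
  have h0 : toBit 0 = 0 := rfl
  have h1 : toBit 1 = 1 := rfl
  have h11 : (1 : ZMod 2) + 1 = 0 := rfl
  rcases h2 a with rfl | rfl <;> rcases h2 b with rfl | rfl <;> rcases h2 x with rfl | rfl <;>
    rcases h2 y with rfl | rfl <;> simp [pauli, pauliIndex, sgn, h0, h1, h11]

theorem pauliString_pauliEquiv (a b x y : Fin n → ZMod 2) :
    pauliString (pauliEquiv n (a, b)) (toBasis n x) (toBasis n y) =
      if x = y + a then pauliPhase a b * ((sgn (b ⬝ᵥ y) : ℝ) : ℂ) else 0 := by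
  have h : pauliString (pauliEquiv n (a, b)) (toBasis n x) (toBasis n y) =
      ∏ k, pauli (pauliIndex (a k, b k)) (toBit (x k)) (toBit (y k)) := rfl
  rw [h]
  simp only [pauli_pauliIndex]
  split_ifs with hx
  · rw [dotProduct, sgn_sum, pauliPhase, Complex.ofReal_prod, ← Finset.prod_mul_distrib]
    exact Finset.prod_congr rfl fun k _ => if_pos (congrFun hx k)
  · obtain ⟨k, hk⟩ := Function.ne_iff.mp hx
    exact Finset.prod_eq_zero (Finset.mem_univ k) (if_neg hk)

theorem pauliPhase_sq (a b : Fin n → ZMod 2) :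
    pauliPhase a b ^ 2 = ((sgn (a ⬝ᵥ b) : ℝ) : ℂ) := by
  rw [pauliPhase, ← Finset.prod_pow, dotProduct, sgn_sum, Complex.ofReal_prod]
  refine Finset.prod_congr rfl fun k _ => ?_
  unfold sgn
  split_ifs <;> simp

theorem abs_re_pauliPhase_le_one (a b : Fin n → ZMod 2) : |(pauliPhase a b).re| ≤ 1 := by
  refine (Complex.abs_re_le_norm _).trans (le_of_eq ?_)
  rw [pauliPhase, norm_prod]
  refine Finset.prod_eq_one fun k _ => ?_
  split_ifs <;> simp

/-- The amplitudes `2 ^ (-n/2) (-1) ^ (xᵀ U x)`. -/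
def quadVec (U : Matrix (Fin n) (Fin n) (ZMod 2)) : Basis n → ℂ :=
  fun x => ((sgn (quad U ((toBasis n).symm x)) * (√(2 ^ n))⁻¹ : ℝ) : ℂ)

theorem quadVec_mul_star (U : Matrix (Fin n) (Fin n) (ZMod 2)) (x y : Fin n → ZMod 2) :
    quadVec U (toBasis n x) * star (quadVec U (toBasis n y)) =
      ((sgn (quad U x) * sgn (quad U y) / 2 ^ n : ℝ) : ℂ) := by
  simp only [quadVec, Equiv.symm_apply_apply]
  rw [Complex.star_def, Complex.conj_ofReal, ← Complex.ofReal_mul]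
  congr 1
  have h : (√(2 ^ n : ℝ))⁻¹ * (√(2 ^ n : ℝ))⁻¹ = 1 / 2 ^ n := by
    rw [← mul_inv, Real.mul_self_sqrt (by positivity), one_div]
  calc _ = sgn (quad U x) * sgn (quad U y) * ((√(2 ^ n : ℝ))⁻¹ * (√(2 ^ n : ℝ))⁻¹) := by ring
    _ = _ := by rw [h]; ring

/-- The state with amplitudes `2 ^ (-n/2) (-1) ^ (xᵀ U x)`. -/
def quadState (U : Matrix (Fin n) (Fin n) (ZMod 2)) : QState n where
  mat := Matrix.vecMulVec (quadVec U) (star (quadVec U))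
  posSemidef := Matrix.posSemidef_vecMulVec_self_star _
  trace_eq_one := by
    have h : ∀ x : Fin n → ZMod 2, quadVec U (toBasis n x) * star (quadVec U (toBasis n x)) = ((1 / 2 ^ n : ℝ) : ℂ) :=
      fun x => by rw [quadVec_mul_star, sgn_mul_self]
    rw [Matrix.trace_vecMulVec, dotProduct, ← (toBasis n).sum_comp]
    simp only [Pi.star_apply, h]
    simp

/-- The stabilizer `D X ^ a D` of `quadVec U`, with `D` the diagonal matrix of its signs. -/
def quadShift (U : Matrix (Fin n) (Fin n) (ZMod 2)) (a : Fin n → ZMod 2) : Op n :=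
  Matrix.of fun i j =>
    let x := (toBasis n).symm i
    let y := (toBasis n).symm j
    if x = y + a then ((sgn (quad U x) * sgn (quad U y) : ℝ) : ℂ) else 0

theorem quadShift_apply (U : Matrix (Fin n) (Fin n) (ZMod 2)) (a x y : Fin n → ZMod 2) :
    quadShift U a (toBasis n x) (toBasis n y) =
      if x = y + a then ((sgn (quad U x) * sgn (quad U y) : ℝ) : ℂ) else 0 := by
  simp [quadShift]

theorem quadShift_mulVec (U : Matrix (Fin n) (Fin n) (ZMod 2)) (a : Fin n → ZMod 2) :
    quadShift U a *ᵥ quadVec U = quadVec U := by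
  funext i
  obtain ⟨x, rfl⟩ := (toBasis n).surjective i
  rw [mulVec, dotProduct, ← (toBasis n).sum_comp]
  have h : ∀ y : Fin n → ZMod 2, x = y + a ↔ x - a = y := fun y => sub_eq_iff_eq_add.symm
  simp only [quadShift_apply, h, ite_mul, zero_mul, Finset.sum_ite_eq, Finset.mem_univ, if_true]
  simp only [quadVec, Equiv.symm_apply_apply, ← Complex.ofReal_mul]
  congr 1
  calc _ = sgn (quad U x) * (sgn (quad U (x - a)) * sgn (quad U (x - a))) * (√(2 ^ n : ℝ))⁻¹ := by
        ring
    _ = _ := by rw [sgn_mul_self, mul_one]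

theorem quadShift_add (U : Matrix (Fin n) (Fin n) (ZMod 2)) (a b : Fin n → ZMod 2) :
    quadShift U (a + b) = quadShift U a * quadShift U b := by
  refine op_ext fun x z => ?_
  rw [Matrix.mul_apply, ← (toBasis n).sum_comp]
  simp only [quadShift_apply, mul_ite, mul_zero, Finset.sum_ite_eq',
    Finset.mem_univ, if_true]
  rw [add_assoc, add_comm a b, ite_mul, zero_mul, ← Complex.ofReal_mul]
  refine if_congr Iff.rfl (congrArg _ ?_) rfl
  calc _ = sgn (quad U x) * 1 * sgn (quad U z) := by ring
    _ = _ := by rw [← sgn_mul_self (quad U (z + b))]; ring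

theorem quadShift_zero (U : Matrix (Fin n) (Fin n) (ZMod 2)) : quadShift U 0 = 1 := by
  refine op_ext fun x y => ?_
  rw [quadShift_apply, Matrix.one_apply, add_zero]
  refine if_ctx_congr (toBasis n).injective.eq_iff.symm (fun h => ?_) fun _ => rfl
  rw [(toBasis n).injective h, sgn_mul_self, Complex.ofReal_one]

/-- By `quad_add` the signs of `D X^a D` are those of `X^a Z^(Ba)` up to a global sign. As `a ⬝ᵥ B a
= 0`, the phase of the Hermitian Pauli string is real, hence `±1`. -/
theorem quadShift_mem_pauliOps (U : Matrix (Fin n) (Fin n) (ZMod 2)) (a : Fin n → ZMod 2) :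
    quadShift U a ∈ pauliOps n := by
  set b := (U + Uᵀ) *ᵥ a
  have hphase : pauliPhase a b = 1 ∨ pauliPhase a b = -1 := by
    rw [← sq_eq_one_iff, pauliPhase_sq, dotProduct_polar_self, sgn_zero, Complex.ofReal_one]
  have hs : ∃ s : ℤˣ, ((s : ℤ) : ℂ) * pauliPhase a b = ((sgn (quad U a) : ℝ) : ℂ) := by
    unfold sgn
    rcases hphase with h | h <;> split_ifs
    · exact ⟨1, by simp [h]⟩
    · exact ⟨-1, by simp [h]⟩
    · exact ⟨-1, by simp [h]⟩
    · exact ⟨1, by simp [h]⟩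
  obtain ⟨s, hs⟩ := hs
  refine ⟨s, pauliEquiv n (a, b), ?_⟩
  refine op_ext fun x y => ?_
  rw [signedPauli, Matrix.smul_apply, smul_eq_mul, quadShift_apply, pauliString_pauliEquiv, mul_ite, mul_zero, ← mul_assoc, hs]
  refine if_ctx_congr Iff.rfl (fun h => ?_) fun _ => rfl
  rw [h, quad_add, sgn_add, sgn_add, ← Complex.ofReal_mul]
  congr 1
  calc _ = (sgn (quad U y) * sgn (quad U y)) * (sgn (quad U a) * sgn (b ⬝ᵥ y)) := by ring
    _ = _ := by rw [sgn_mul_self, one_mul]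

theorem quadVec_ne_zero (U : Matrix (Fin n) (Fin n) (ZMod 2)) (x : Fin n → ZMod 2) :
    quadVec U (toBasis n x) ≠ 0 := by
  intro h
  have h1 := quadVec_mul_star U x x
  rw [h, zero_mul, sgn_mul_self] at h1
  have h2 : (0 : ℝ) = 1 / 2 ^ n := by exact_mod_cast h1
  have h3 : (0 : ℝ) < 1 / 2 ^ n := by positivity
  exact h3.ne h2

theorem isStabilizerState_quadState (U : Matrix (Fin n) (Fin n) (ZMod 2)) :
    IsStabilizerState (quadState U) := by
  let f : Multiplicative (Fin n → ZMod 2) →* Op n :=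
    { toFun := fun a => quadShift U a.toAdd
      map_one' := quadShift_zero U
      map_mul' := fun a b => quadShift_add U a.toAdd b.toAdd }
  have hinj : Function.Injective f.toHomUnits := by
    intro a b hab
    have h1 : quadShift U a.toAdd = quadShift U b.toAdd := congrArg Units.val hab
    have h2 : quadShift U a.toAdd (toBasis n a.toAdd) (toBasis n 0) =
      quadShift U b.toAdd (toBasis n a.toAdd) (toBasis n 0) := by rw [h1]
    rw [quadShift_apply, quadShift_apply, zero_add, zero_add, if_pos rfl] at h2
    by_contra hne
    rw [if_neg fun h => hne (Multiplicative.toAdd.injective h), ← sgn_add] at h2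
    have h3 := abs_sgn (quad U a.toAdd + quad U 0)
    rw [Complex.ofReal_eq_zero.1 h2] at h3
    simp at h3
  refine ⟨f.toHomUnits.range, ?_, ?_, ?_, ?_, quadVec U, rfl, ?_⟩
  · rintro _ ⟨a, rfl⟩
    exact quadShift_mem_pauliOps U a.toAdd
  · rintro ⟨a, ha⟩
    have h1 : quadShift U a.toAdd = -1 := congrArg Units.val ha
    have h2 := quadShift_mulVec U a.toAdd
    rw [h1, Matrix.neg_mulVec, Matrix.one_mulVec] at h2
    exact quadVec_ne_zero U 0 (self_eq_neg.1 (congrFun h2 (toBasis n 0)).symm)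
  · rintro _ ⟨a, rfl⟩ _ ⟨b, rfl⟩
    rw [← map_mul, mul_comm, map_mul]
  · rw [← Nat.card_congr (MonoidHom.ofInjective hinj).toEquiv, Nat.card_eq_fintype_card]
    simp
  · rintro _ ⟨a, rfl⟩
    exact quadShift_mulVec U a.toAdd

/-- By `quad_add` the trace is a sum over `y` of the character of `b + B a`, which vanishes unless
`b = B a`. -/
theorem pauliCoeff_quadState (U : Matrix (Fin n) (Fin n) (ZMod 2)) (a b : Fin n → ZMod 2) :
    pauliCoeff (quadState U) (pauliEquiv n (a, b)) =
      if b = (U + Uᵀ) *ᵥ a then (pauliPhase a b).re * sgn (quad U a) else 0 := by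
  have h1 : (pauliString (pauliEquiv n (a, b)) * (quadState U).mat).trace =
      ∑ x : Fin n → ZMod 2, ∑ y : Fin n → ZMod 2, 
        pauliString (pauliEquiv n (a, b)) (toBasis n x) (toBasis n y) *
          (quadVec U (toBasis n y) * star (quadVec U (toBasis n x))) := by
    simp only [Matrix.trace, Matrix.diag_apply, Matrix.mul_apply]
    rw [← (toBasis n).sum_comp]
    refine Finset.sum_congr rfl fun x _ => ?_
    rw [← (toBasis n).sum_comp]
    rfl
  have h2 : ∀ y : Fin n → ZMod 2, sgn (b ⬝ᵥ y) * (sgn (quad U y) * sgn (quad U (y + a)) / 2 ^ n) =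
      sgn (quad U a) / 2 ^ n * (sgn (y ⬝ᵥ b) * sgn (y ⬝ᵥ (U + Uᵀ) *ᵥ a)) := fun y => by
    rw [quad_add, sgn_add, sgn_add, dotProduct_comm b, dotProduct_comm _ y]
    calc _ = (sgn (quad U y) * sgn (quad U y)) * (sgn (quad U a) / 2 ^ n *
          (sgn (y ⬝ᵥ b) * sgn (y ⬝ᵥ (U + Uᵀ) *ᵥ a))) := by ring
      _ = _ := by rw [sgn_mul_self, one_mul]
  rw [pauliCoeff, h1, Finset.sum_comm]
  simp only [pauliString_pauliEquiv, quadVec_mul_star, ite_mul, zero_mul, Finset.sum_ite_eq',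
    Finset.mem_univ, if_true, mul_assoc, ← Complex.ofReal_mul, h2]
  rw [← Finset.mul_sum, ← Complex.ofReal_sum, Complex.re_mul_ofReal, ← Finset.mul_sum,
    sum_sgn_mul_sgn, Fintype.card_fin]
  split_ifs
  · field_simp
  · simp

/-- The phase is independent of `U`, so it can be absorbed into the bounded function. -/
theorem sum_mul_pauliCoeff_quadState (h : (Fin n → Fin 4) → ℝ)
    (U : Matrix (Fin n) (Fin n) (ZMod 2)) :
    ∑ p, h p * pauliCoeff (quadState U) p =
      2 ^ n * corr (fun a b => h (pauliEquiv n (a, b)) * (pauliPhase a b).re) U := by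
  rw [corr, sum_pauliStrings, Fintype.card_fin, mul_div_cancel₀ _ (by positivity)]
  refine Finset.sum_congr rfl fun a _ => ?_
  simp only [pauliCoeff_quadState, mul_ite, mul_zero, Finset.sum_ite_eq',
    Finset.mem_univ, if_true]
  ring

/-! ### The adversarial oracle -/

section Adversary

variable {D : Finset (Measurement n)}

/-- The exact oracle always gives a complete run, so requirements on all runs are never vacuous. -/
theorem SQAlgorithm.exists_run (ρ : QState n) {τ : ℝ} :
    ∀ A : SQAlgorithm n, A.ToleranceAtLeast τ → ∃ k σ, A.Run D ρ k σ
  | .output σ, _ => ⟨0, σ, .output σ⟩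
  | .ask φ t next, h => by
    obtain ⟨k, σ, hrun⟩ := SQAlgorithm.exists_run ρ (next (queryExpect D ρ φ)) (h.2.2 _)
    exact ⟨k + 1, σ, .ask φ t next _ k σ (by rw [sub_self, abs_zero]; exact h.1.le) hrun⟩

/-- If every fixed answer is invalid for, and every fixed output is good for, at most `B` of the
states, then `q` queries suffice for at most `(q + 1) * B` of them. -/
theorem card_le_of_learns {α : Type*} [DecidableEq α] (ρ : α → QState n) (answer : Query n → ℝ)
    {τ ε B : ℝ} (hB0 : 0 ≤ B)
    (hquery : ∀ φ, ∀ T : Finset α, (∀ U ∈ T, τ < |answer φ - queryExpect D (ρ U) φ|) →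
      (T.card : ℝ) ≤ B)
    (houtput : ∀ σ, ∀ T : Finset α, (∀ U ∈ T, sqLoss D σ (ρ U) ≤ ε) → (T.card : ℝ) ≤ B)
    (A : SQAlgorithm n) (hA : A.ToleranceAtLeast τ) (q : ℕ) (T : Finset α)
    (hT : ∀ U ∈ T, ∀ k σ, A.Run D (ρ U) k σ → k ≤ q ∧ sqLoss D σ (ρ U) ≤ ε) :
    (T.card : ℝ) ≤ (q + 1) * B := by
  induction A generalizing q T with
  | output σ =>
    refine (houtput σ T fun U hU => (hT U hU 0 σ (.output σ)).2).trans ?_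
    nlinarith [mul_nonneg (Nat.cast_nonneg (α := ℝ) q) hB0]
  | ask φ t next ih =>
    cases q with
    | zero =>
      have h : T = ∅ := by
        rw [Finset.eq_empty_iff_forall_notMem]
        intro U hU
        obtain ⟨k, σ, hrun⟩ := SQAlgorithm.exists_run (ρ U) (next (queryExpect D (ρ U) φ))
          (hA.2.2 _)
        have := (hT U hU (k + 1) σ (.ask φ t next _ k σ
          (by rw [sub_self, abs_zero]; exact hA.1.le) hrun)).1
        omega
      rw [h]
      simpa using hB0
    | succ q =>
      have h1 : ((T.filter fun U => τ < |answer φ - queryExpect D (ρ U) φ|).card : ℝ) ≤ B :=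
        hquery φ _ fun U hU => (Finset.mem_filter.1 hU).2
      have h2 : ((T.filter fun U => ¬τ < |answer φ - queryExpect D (ρ U) φ|).card : ℝ) ≤
          (q + 1) * B := by
        -- For the surviving states `answer φ` is a valid response, so all of them follow the same
        -- branch with one query fewer.
        refine ih (answer φ) (hA.2.2 _) q _ fun U hU k σ hrun => ?_
        obtain ⟨hU, hval⟩ := Finset.mem_filter.1 hU
        have h3 := hT U hU (k + 1) σ (.ask φ t next (answer φ) k σ
          ((not_lt.1 hval).trans hA.2.1) hrun)
        exact ⟨by omega, h3.2⟩
      have h3 : (T.card : ℝ) = (T.filter fun U => τ < |answer φ - queryExpect D (ρ U) φ|).card +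
          (T.filter fun U => ¬τ < |answer φ - queryExpect D (ρ U) φ|).card := by
        exact_mod_cast (Finset.card_filter_add_card_filter_not (s := T)
          fun U => τ < |answer φ - queryExpect D (ρ U) φ|).symm
      rw [h3]
      push_cast
      linarith

end Adversary

/-! ### The lower bound -/

/-- Few of the states `quadState U` correlate with a given function of the Pauli strings. -/
theorem card_quadState_le (h : (Fin n → Fin 4) → ℝ) (hh : ∀ p, |h p| ≤ 1)
    (T : Finset (Matrix (Fin n) (Fin n) (ZMod 2)))
    (hT : ∀ U ∈ T, (2 : ℝ) ^ n * (2 : ℝ) ^ (-(n / 24 : ℝ)) ≤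
      |∑ p, h p * pauliCoeff (quadState U) p|) (m : ℕ) (hm : Even m) :
    (T.card : ℝ) ≤ 2 ^ (n ^ 2) * (2 : ℝ) ^ (4 * (m : ℝ) ^ 2 - n * m / 8) := by
  have h1 := card_corr_gt_le (fun a b => h (pauliEquiv n (a, b)) * (pauliPhase a b).re)
    (fun a b => by
      rw [abs_mul]
      exact mul_le_one₀ (hh _) (abs_nonneg _) (abs_re_pauliPhase_le_one a b)) T
    (fun U hU => by
      have h2 := hT U hU
      rw [sum_mul_pauliCoeff_quadState, abs_mul, abs_of_pos (by positivity : (0 : ℝ) < 2 ^ n)] at h2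
      rw [Fintype.card_fin]
      exact le_of_mul_le_mul_left h2 (by positivity)) m hm
  rwa [Fintype.card_fin] at h1

/-- The answer to `φ` for outcomes that are fair coins. -/
def fairAnswer (φ : Query n) : ℝ :=
  Finset.expect (pauliMeasurements n) fun E => ((φ E 1 : ℝ) + (φ E (-1) : ℝ)) / 2

/-- The correlation of `φ` with the outcome of the measurement of a Pauli string. -/
def queryCoeff (φ : Query n) (p : Fin n → Fin 4) : ℝ :=
  ((φ (pauliMeasurement 1 p) 1 : ℝ) - (φ (pauliMeasurement 1 p) (-1) : ℝ) -
    ((φ (pauliMeasurement (-1) p) 1 : ℝ) - (φ (pauliMeasurement (-1) p) (-1) : ℝ))) / 4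

theorem abs_queryCoeff_le_one (φ : Query n) (p : Fin n → Fin 4) : |queryCoeff φ p| ≤ 1 := by
  have h : ∀ E s, -1 ≤ (φ E s : ℝ) ∧ (φ E s : ℝ) ≤ 1 := fun E s => (φ E s).2
  have h1 := h (pauliMeasurement 1 p) 1
  have h2 := h (pauliMeasurement 1 p) (-1)
  have h3 := h (pauliMeasurement (-1) p) 1
  have h4 := h (pauliMeasurement (-1) p) (-1)
  rw [queryCoeff, abs_le]
  constructor <;> linarith

theorem queryExpect_sub_fairAnswer (ρ : QState n) (φ : Query n) :
    queryExpect (pauliMeasurements n) ρ φ - fairAnswer φ =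
      (∑ p, queryCoeff φ p * pauliCoeff ρ p) / 4 ^ n := by
  rw [queryExpect, fairAnswer, expect_pauliMeasurements, expect_pauliMeasurements, ← sub_div,
    ← Finset.sum_sub_distrib, mul_comm (2 : ℝ), ← div_div, div_right_comm, Finset.sum_div]
  congr 1
  refine Finset.sum_congr rfl fun p _ => ?_
  simp only [acceptProb_pauliMeasurement, queryCoeff]
  push_cast
  ring

theorem card_invalid_fairAnswer_le (φ : Query n) {τ : ℝ} (hτ : (2 : ℝ) ^ (-(25 / 24 * n : ℝ)) ≤ τ)
    (T : Finset (Matrix (Fin n) (Fin n) (ZMod 2)))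
    (hT : ∀ U ∈ T, τ < |fairAnswer φ - queryExpect (pauliMeasurements n) (quadState U) φ|)
    (m : ℕ) (hm : Even m) :
    (T.card : ℝ) ≤ 2 ^ (n ^ 2) * (2 : ℝ) ^ (4 * (m : ℝ) ^ 2 - n * m / 8) := by
  refine card_quadState_le (queryCoeff φ) (abs_queryCoeff_le_one φ) T (fun U hU => ?_) m hm
  have h1 := hτ.trans (hT U hU).le
  rw [abs_sub_comm, queryExpect_sub_fairAnswer, abs_div,
    abs_of_pos (by positivity : (0 : ℝ) < 4 ^ n), le_div_iff₀ (by positivity)] at h1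
  -- The exponent `25/24` is chosen so that `4^n * 2^(-25n/24) = 2^n * 2^(-n/24)`, the threshold of
  -- `card_quadState_le`.
  refine le_trans (le_of_eq ?_) h1
  rw [show (4 : ℝ) = 2 ^ 2 by norm_num, ← pow_mul, ← Real.rpow_natCast, ← Real.rpow_natCast,
    ← Real.rpow_add (by norm_num), ← Real.rpow_add (by norm_num)]
  congr 1
  push_cast
  ring

/-- Expanding the square, loss at most `ε` forces `2 ⟨σ, ρ⟩ ≥ (1 - max θ 0) 2^n` for the vectors of
Pauli coefficients, which is a large correlation with the bounded function `pauliCoeff σ`. -/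
theorem card_sqLoss_le (σ : QState n) {ε θ : ℝ} (hε : ε ≤ θ * (1 / 2 ^ n - 1 / 4 ^ n))
    (hn : (2 : ℝ) ^ (-(n / 24 : ℝ)) ≤ (1 - max θ 0) / 2)
    (T : Finset (Matrix (Fin n) (Fin n) (ZMod 2)))
    (hT : ∀ U ∈ T, sqLoss (pauliMeasurements n) σ (quadState U) ≤ ε) (m : ℕ) (hm : Even m) :
    (T.card : ℝ) ≤ 2 ^ (n ^ 2) * (2 : ℝ) ^ (4 * (m : ℝ) ^ 2 - n * m / 8) := by
  refine card_quadState_le (pauliCoeff σ) (abs_pauliCoeff_le_one σ) T (fun U hU => ?_) m hm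
  have h1 := sqNorm_of_isStabilizerState (isStabilizerState_quadState U)
  have h2 := hT U hU
  have h4 : (4 : ℝ) ^ n = 2 ^ n * 2 ^ n := by rw [← mul_pow]; norm_num
  rw [sqNorm_eq, div_eq_iff (by positivity), h4, one_div,
    inv_mul_cancel_left₀ (by positivity)] at h1
  rw [sqLoss_eq, div_le_iff₀ (by positivity)] at h2
  have h3 : ∑ p, (pauliCoeff σ p - pauliCoeff (quadState U) p) ^ 2 =
      ∑ p, pauliCoeff σ p ^ 2 + ∑ p, pauliCoeff (quadState U) p ^ 2 -
        2 * ∑ p, pauliCoeff σ p * pauliCoeff (quadState U) p := by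
    rw [Finset.mul_sum, ← Finset.sum_add_distrib, ← Finset.sum_sub_distrib]
    exact Finset.sum_congr rfl fun p _ => by ring
  have h5 : 0 ≤ ∑ p, pauliCoeff σ p ^ 2 := Finset.sum_nonneg fun p _ => sq_nonneg _
  -- `θ` may be negative; replacing it by `max θ 0` permits the step from `2^n - 1` to `2^n`.
  have h6 : ε * 4 ^ n ≤ max θ 0 * 2 ^ n := by
    have h7 : (1 : ℝ) ≤ 2 ^ n := one_le_pow₀ (by norm_num)
    calc ε * 4 ^ n ≤ θ * (1 / 2 ^ n - 1 / 4 ^ n) * 4 ^ n :=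
          mul_le_mul_of_nonneg_right hε (by positivity)
      _ = θ * (2 ^ n - 1) := by
          rw [h4]
          field_simp
      _ ≤ max θ 0 * (2 ^ n - 1) := mul_le_mul_of_nonneg_right (le_max_left _ _) (by linarith)
      _ ≤ max θ 0 * 2 ^ n := mul_le_mul_of_nonneg_left (by linarith) (le_max_right _ _)
  have h8 := mul_le_mul_of_nonneg_left hn (by positivity : (0 : ℝ) ≤ 2 ^ n)
  refine le_trans ?_ (le_abs_self _)
  rw [h3, h1] at h2
  linarith

theorem queries_lower_bound {θ : ℝ} (hn192 : 192 ≤ n)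
    (hn : (2 : ℝ) ^ (-(n / 24 : ℝ)) ≤ (1 - max θ 0) / 2)
    {τ : ℝ} (hτ : (2 : ℝ) ^ (-(25 / 24 * n : ℝ)) ≤ τ)
    {ε : ℝ} (hε : ε ≤ θ * (1 / 2 ^ n - 1 / 4 ^ n)) {q : ℕ}
    (hq : SQLearnable (pauliMeasurements n) (stabilizerStates n) ε τ q) :
    (2 : ℝ) ^ (1 / 4608 * (n : ℝ) ^ 2) ≤ q := by
  obtain ⟨A, hA, hlearn⟩ := hq
  -- An even `m` with `n/96 ≤ m ≤ n/48`: then `4m² ≤ nm/12`, so `4m² - nm/8 ≤ -nm/24 ≤ -n²/2304`.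
  set m := 2 * (n / 96) with hm_def
  have hm : Even m := even_two_mul _
  have h1 := card_le_of_learns (D := pauliMeasurements n) quadState fairAnswer
    (B := 2 ^ (n ^ 2) * (2 : ℝ) ^ (4 * (m : ℝ) ^ 2 - n * m / 8)) (by positivity)
    (fun φ T hT => card_invalid_fairAnswer_le φ hτ T hT m hm)
    (fun σ T hT => card_sqLoss_le σ hε hn T hT m hm) A hA q Finset.univ
    (fun U _ k σ hrun => hlearn _ (isStabilizerState_quadState U) k σ hrun)
  have hcard : ((Finset.univ : Finset (Matrix (Fin n) (Fin n) (ZMod 2))).card : ℝ) =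
      2 ^ (n ^ 2) := by
    have : Fintype.card (Fin n → Fin n → ZMod 2) = 2 ^ (n ^ 2) := by
      simp [← pow_mul, sq]
    exact_mod_cast this
  rw [hcard, mul_left_comm] at h1
  have h2 : 1 ≤ ((q : ℝ) + 1) * (2 : ℝ) ^ (4 * (m : ℝ) ^ 2 - n * m / 8) :=
    le_of_mul_le_mul_left (by rwa [mul_one]) (by positivity : (0 : ℝ) < 2 ^ (n ^ 2))
  have hm1 : (m : ℝ) * 48 ≤ n := by
    have : m * 48 ≤ n := by omega
    exact_mod_cast this
  have hm2 : (n : ℝ) ≤ m * 96 := by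
    have : n ≤ m * 96 := by omega
    exact_mod_cast this
  have hn0 : (192 : ℝ) ≤ n := by exact_mod_cast hn192
  -- The exponent is half of `n²/2304`: from `y² ≤ q + 1` and `y ≥ 2` the `+ 1` is absorbed, leaving
  -- `y ≤ q`.
  set y : ℝ := (2 : ℝ) ^ (1 / 4608 * (n : ℝ) ^ 2) with hy
  have h3 : (2 : ℝ) ^ (4 * (m : ℝ) ^ 2 - n * m / 8) ≤ (y * y)⁻¹ := by
    rw [hy, ← Real.rpow_add (by norm_num), ← Real.rpow_neg (by norm_num)]
    refine Real.rpow_le_rpow_of_exponent_le (by norm_num) ?_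
    nlinarith [mul_le_mul_of_nonneg_left hm1 (Nat.cast_nonneg (α := ℝ) m),
      mul_le_mul_of_nonneg_left hm2 (Nat.cast_nonneg (α := ℝ) n)]
  have hy0 : 0 < y := by positivity
  have h4 : y * y ≤ q + 1 := by
    have h5 := h2.trans (mul_le_mul_of_nonneg_left h3 (by positivity))
    rwa [← div_eq_mul_inv, le_div_iff₀ (by positivity), one_mul] at h5
  have hy2 : 2 ≤ y := by
    calc (2 : ℝ) = 2 ^ (1 : ℝ) := by norm_num
      _ ≤ y := Real.rpow_le_rpow_of_exponent_le (by norm_num) (by nlinarith)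
  nlinarith

theorem eventually_two_rpow_neg_le {η : ℝ} (hη : 0 < η) :
    ∀ᶠ n : ℕ in Filter.atTop, (2 : ℝ) ^ (-(n / 24 : ℝ)) ≤ η := by
  have h1 := tendsto_pow_atTop_nhds_zero_of_lt_one (r := (2 : ℝ) ^ (-(1 / 24) : ℝ)) (by positivity)
    (Real.rpow_lt_one_of_one_lt_of_neg (by norm_num) (by norm_num))
  filter_upwards [h1.eventually (eventually_le_nhds hη)] with n hn
  refine le_trans (le_of_eq ?_) hn
  rw [← Real.rpow_natCast, ← Real.rpow_mul (by norm_num)]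
  congr 1
  ring

end SQStab

end

theorem mainTheorem1 :
    -- the lower bound: one exponent `A` for the tolerance and one constant `c` in `2 ^ (c n²)`;
    -- the loss may be any fixed fraction `θ < 1` of the loss of the maximally mixed state
    (∃ A : ℝ, 1 < A ∧ ∃ c : ℝ, 0 < c ∧ ∀ θ : ℝ, θ < 1 → ∀ᶠ n : ℕ in Filter.atTop,
      ∀ τ : ℝ, (2 : ℝ) ^ (-(A * n)) ≤ τ →
      ∀ ε : ℝ, ε ≤ θ * (1 / 2 ^ n - 1 / 4 ^ n) →
      ∀ q : ℕ, SQStab.SQLearnable (SQStab.pauliMeasurements n) (SQStab.stabilizerStates n) ε τ q →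
        (2 : ℝ) ^ (c * (n : ℝ) ^ 2) ≤ q) ∧
    -- the performance of the maximally mixed state, on every state
    (∀ (n : ℕ) (ρ : SQStab.QState n),
      SQStab.sqNorm (SQStab.pauliMeasurements n) ρ =
        SQStab.sqLoss (SQStab.pauliMeasurements n) (SQStab.maxMixed n) ρ + 1 / 4 ^ n) ∧
    -- and on stabilizer states
    (∀ (n : ℕ), ∀ ρ ∈ SQStab.stabilizerStates n,
      SQStab.sqNorm (SQStab.pauliMeasurements n) ρ = 1 / 2 ^ n ∧
      SQStab.sqLoss (SQStab.pauliMeasurements n) (SQStab.maxMixed n) ρ =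
        1 / 2 ^ n - 1 / 4 ^ n) := by
  refine ⟨⟨25 / 24, by norm_num, 1 / 4608, by norm_num, fun θ hθ => ?_⟩,
    fun n ρ => SQStab.sqNorm_eq_sqLoss_maxMixed_add ρ, fun n ρ hρ => ?_⟩
  · have hη : 0 < (1 - max θ 0) / 2 := by
      have := max_lt hθ one_pos
      linarith
    filter_upwards [SQStab.eventually_two_rpow_neg_le hη, Filter.eventually_ge_atTop 192]
      with n hn hn192 τ hτ ε hε q hq
    exact SQStab.queries_lower_bound hn192 hn hτ hε hq
  · have h := SQStab.sqNorm_of_isStabilizerState hρ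
    exact ⟨h, by rw [← h, SQStab.sqNorm_eq_sqLoss_maxMixed_add]; ring⟩
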